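/- Let $p$ be an odd prime, let $m\ge 5$ be odd, and let $k\ge 1$ satisfy $\gcd(m,k)=1$. Let $\pi$ be a primitive element of $\mathbb{F}_{p^m}$ (a generator of $\mathbb{F}_{p^m}^*$), and let $\mathcal{C}_{(p,m,k)}$ be the cyclic code of length $p^m-1$ over $\mathbb{F}_p$ with parity-check polynomial $h_0h_{-0}h_1h_{-1}h_2$. Here the five factors are the minimal polynomials over $\mathbb{F}_p$ of $\pi^{-1}$, $-\pi^{-1}$, $\pi^{-(p^k+1)/2}$, $-\pi^{-(p^k+1)/2}$ and $\pi^{-(p^{2k}+1)/2}$, respectively. (A cyclic code of length $n$ is an ideal of $\mathbb{F}_p[x]/(x^n-1)$, its generator polynomial $g$ is the monic polynomial of lowest degree in the ideal, and its parity-check polynomial is $(x^n-1)/g$.) For $u,v,w\in\mathbb{F}_{p^m}$ put $$D(u,v,w)=\sum_{y\in\mathbb{F}_p^*}\ \sum_{x\in\mathbb{F}_{p^m}}\zeta_p^{\,y\,\mathrm{Tr}(ux^2+vx^{p^k+1}+wx^{p^{2k}+1})},$$ where $\zeta_p\in\mathbb{C}$ is a primitive $p$-th root of unity and $\mathrm{Tr}$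 is the trace from $\mathbb{F}_{p^m}$ to $\mathbb{F}_p$. For $\varepsilon=\pm1$ and $i\in\{1,3\}$ let $n_0$ and $n_\varepsilon$ be the numbers of pairs $(u,v)\in\mathbb{F}_{p^m}^2$ with $D(u,v,0)=0$ and with $D(u,v,0)=\varepsilon(p-1)p^{\frac{m+1}{2}}$, respectively. For a fixed $w\in\mathbb{F}_{p^m}^*$ let $n_0^*$ and $n_{\varepsilon,i}$ be the numbers of pairs $(u,v)$ with $D(u,v,w)=0$ and with $D(u,v,w)=\varepsilon(p-1)p^{\frac{m+i}{2}}$, respectively. Then these numbers do not depend on the choice of $w\ne0$, and $$n_0=(p^m-1)(p^m-p^{m-1}+1),\qquad n_\varepsilon=\tfrac12(p^m-1)\big(p^{m-1}+\varepsilon p^{\frac{m-1}{2}}\big),$$ $$n_0^*=p^{2m}-p^{2m-1}+p^{2m-4}-p^{m-3},$$ $$n_{\varepsilon,1}=\frac{(p^{m+2}-p^m-p^{m-1}+1)\big(p^{m-1}+\varepsilon p^{\frac{m-1}{2}}\big)}{2(p^2-1)},\qquad n_{\varepsilon,3}=\frac{(p^{m-1}-1)\big(p^{m-3}+\varepsilon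 p^{\frac{m-3}{2}}\big)}{2(p^2-1)}.$$ The code $\mathcal{C}_{(p,m,k)}$ is cyclic, with parameters $[\,p^m-1,\ 5m,\ \tfrac12(p-1)(p^{m-1}-p^{\frac{m-1}{2}})\,]$ (length, dimension, minimum Hamming distance), and its weight distribution is given by the following table. The number of codewords of weight $i$ is the sum of the frequencies of the rows of weight $i$, and is $0$ if there is no such row. (For $p=3$ the 7th and 15th rows have equal weight, and so do the 11th and 14th.) $$\begin{array}{ll} \text{Weight}&\text{Frequency}\\ \hline 0&1\\ \frac12(p-1)p^{m-1}&2n_0\\ \frac12(p-1)(p^{m-1}+p^{\frac{m-1}2})&2n_{-1}\\ \frac12(p-1)(p^{m-1}-p^{\frac{m-1}2})&2n_1\\ (p-1)(p^{m-1}-\frac12p^{\frac{m-1}2})&2n_0n_1+2(p^m-1)n_0^*n_{1,1}\\ (p-1)(p^{m-1}-\frac12p^{\frac{m+1}2})&2(p^m-1)n_0^*n_{1,3}\\ (p-1)(p^{m-1}-p^{\frac{m-1}2})&n_1^2+(p^m-1)n_{1,1}^2\\ (p-1)(p^{m-1}-p^{\frac{m+1}2})&(p^m-1)n_{1,3}^2\\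 (p-1)(p^{m-1}+\frac12p^{\frac{m-1}2})&2n_0n_{-1}+2(p^m-1)n_0^*n_{-1,1}\\ (p-1)(p^{m-1}+\frac12p^{\frac{m+1}2})&2(p^m-1)n_0^*n_{-1,3}\\ (p-1)(p^{m-1}+p^{\frac{m-1}2})&n_{-1}^2+(p^m-1)n_{-1,1}^2\\ (p-1)(p^{m-1}+p^{\frac{m+1}2})&(p^m-1)n_{-1,3}^2\\ (p-1)(p^{m-1}-\frac12p^{\frac{m-1}2}-\frac12p^{\frac{m+1}2})&2(p^m-1)n_{1,1}n_{1,3}\\ (p-1)(p^{m-1}-\frac12p^{\frac{m-1}2}+\frac12p^{\frac{m+1}2})&2(p^m-1)n_{1,1}n_{-1,3}\\ (p-1)(p^{m-1}+\frac12p^{\frac{m-1}2}-\frac12p^{\frac{m+1}2})&2(p^m-1)n_{-1,1}n_{1,3}\\ (p-1)(p^{m-1}+\frac12p^{\frac{m-1}2}+\frac12p^{\frac{m+1}2})&2(p^m-1)n_{-1,1}n_{-1,3}\\ (p-1)p^{m-1}&n_0^2+2n_1n_{-1}+(p^m-1)n_0^{*2}+2(p^m-1)(n_{1,1}n_{-1,1}+n_{1,3}n_{-1,3})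 \end{array}$$ -/

import Mathlib

open Polynomial

/-- The linear map sending a word `(c₀, …, c_{n-1})` to the polynomial `c₀ + c₁ X + ⋯ + c_{n-1} X^{n-1}`. -/
noncomputable def wordPoly (K : Type*) [Field K] (n : ℕ) : (Fin n → K) →ₗ[K] K[X] :=
  ∑ i : Fin n, (Polynomial.monomial (i : ℕ)).comp (LinearMap.proj i)

/-- The ideal `(Xⁿ - 1)` of `K[X]`. -/
noncomputable def cyclicModulus (K : Type*) [Field K] (n : ℕ) : Ideal K[X] :=
  Ideal.span {(X ^ n - 1 : K[X])}

/-- The principal ideal of `K[X]/(Xⁿ - 1)` consisting of the multiples of the class of `g`. -/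
noncomputable def cyclicIdeal {K : Type*} [Field K] (n : ℕ) (g : K[X]) :
    Ideal (K[X] ⧸ cyclicModulus K n) :=
  Ideal.span {Ideal.Quotient.mk (cyclicModulus K n) g}

/-- The words of length `n` whose polynomial lies, modulo `Xⁿ - 1`, in the ideal `(g)`. -/
noncomputable def codeOfGenerator {K : Type*} [Field K] (n : ℕ) (g : K[X]) :
    Submodule K (Fin n → K) :=
  ((cyclicIdeal n g).restrictScalars K).comap
    ((Ideal.Quotient.mkₐ K (cyclicModulus K n)).toLinearMap ∘ₗ wordPoly K n)

/-- A code is cyclic if with `(c₀, …, c_{n-1})` it contains `(c_{n-1}, c₀, …, c_{n-2})`. -/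
def IsCyclicCode {K : Type*} [Field K] {n : ℕ} (C : Submodule K (Fin n → K)) : Prop :=
  ∀ c ∈ C, (fun i => c ((finRotate n).symm i)) ∈ C

/-- `g` is the generator polynomial of `C`: the code `C` is the ideal `(g)` of `K[X]/(Xⁿ - 1)`, and
`g` is monic of the lowest degree among the monic polynomials in that ideal. -/
def IsGeneratorPolynomial {K : Type*} [Field K] {n : ℕ} (C : Submodule K (Fin n → K))
    (g : K[X]) : Prop :=
  g.Monic ∧ C = codeOfGenerator n g ∧
    ∀ f : K[X], f.Monic → Ideal.Quotient.mk (cyclicModulus K n) f ∈ cyclicIdeal n g →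
      g.natDegree ≤ f.natDegree

/-- `h` is the parity-check polynomial of `C`: `h = (Xⁿ - 1) / g` for the generator polynomial `g`
of `C`. -/
def IsParityCheckPolynomial {K : Type*} [Field K] {n : ℕ} (C : Submodule K (Fin n → K))
    (h : K[X]) : Prop :=
  ∃ g : K[X], IsGeneratorPolynomial C g ∧ g * h = X ^ n - 1

/-- The cyclic code of length `n` with parity-check polynomial `h`, for a monic divisor `h` of
`Xⁿ - 1`; its generator polynomial is the quotient `(Xⁿ - 1) / h`. -/
noncomputable def codeOfParityCheck {K : Type*} [Field K] (n : ℕ) (h : K[X]) :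
    Submodule K (Fin n → K) :=
  codeOfGenerator n ((X ^ n - 1) /ₘ h)

/-- `C` is an `[n, l, d]` code: a linear code of length `n`, dimension `l` and minimum Hamming
distance `d`. -/
def HasParameters {K : Type*} [Field K] [DecidableEq K] {n : ℕ} (C : Submodule K (Fin n → K))
    (l d : ℕ) : Prop :=
  Module.finrank K C = l ∧
    IsLeast {e : ℕ | ∃ x ∈ C, ∃ y ∈ C, x ≠ y ∧ hammingDist x y = e} d

/-- The number of codewords of `C` of Hamming weight `i`. -/
noncomputable def weightCount {K : Type*} [Field K] [DecidableEq K] {n : ℕ}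
    (C : Submodule K (Fin n → K)) (i : ℕ) : ℕ :=
  Set.ncard {c : Fin n → K | c ∈ C ∧ hammingNorm c = i}

section FiveZeros

variable (p : ℕ) [Fact p.Prime] {F : Type*} [Field F] [Algebra (ZMod p) F]

/-- The product of the minimal polynomials over `𝔽_p` of `π⁻¹`, `-π⁻¹`, `π^{-(p^k+1)/2}`,
`-π^{-(p^k+1)/2}` and `π^{-(p^{2k}+1)/2}`. -/
noncomputable def fiveZeroPoly (k : ℕ) (π : F) : (ZMod p)[X] :=
  minpoly (ZMod p) π⁻¹ * minpoly (ZMod p) (-π⁻¹) *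
    minpoly (ZMod p) (π ^ ((p ^ k + 1) / 2))⁻¹ *
    minpoly (ZMod p) (-(π ^ ((p ^ k + 1) / 2))⁻¹) *
    minpoly (ZMod p) (π ^ ((p ^ (2 * k) + 1) / 2))⁻¹

/-- The cyclic code `C_(p,m,k)` of length `p^m - 1`. -/
noncomputable def fiveZeroCode (m k : ℕ) (π : F) :
    Submodule (ZMod p) (Fin (p ^ m - 1) → ZMod p) :=
  codeOfParityCheck (p ^ m - 1) (fiveZeroPoly p k π)

variable [Fintype F]

/-- The exponential sum `D(u,v,w)`, the sum over `y ∈ 𝔽_p^*` and `x ∈ F` of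
`ζ ^ (y Tr(u x² + v x^{p^k+1} + w x^{p^{2k}+1}))`, for a `p`-th root of unity `ζ`. -/
noncomputable def expSumD (k : ℕ) (ζ : ℂ) (u v w : F) : ℂ :=
  ∑ y : (ZMod p)ˣ, ∑ x : F,
    ζ ^ ((y : ZMod p) * Algebra.trace (ZMod p) F
      (u * x ^ 2 + v * x ^ (p ^ k + 1) + w * x ^ (p ^ (2 * k) + 1))).val

/-- The number of `(u,v) ∈ F²` with `D(u,v,w) = z`. -/
noncomputable def countD (k : ℕ) (ζ : ℂ) (w : F) (z : ℂ) : ℕ :=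
  Set.ncard {a : F × F | expSumD p k ζ a.1 a.2 w = z}

end FiveZeros

/-- The rows (weight, frequency) of the weight table, for given values of `n₀`, `n₁`, `n₋₁` (`n0`,
`nP`, `nM`) and `n₀*`, `n_{1,1}`, `n_{-1,1}`, `n_{1,3}`, `n_{-1,3}` (`n0s`, `nP1`, `nM1`, `nP3`,
`nM3`). -/
def weightTable (p m : ℕ) (n0 nP nM n0s nP1 nM1 nP3 nM3 : ℚ) : List (ℚ × ℚ) :=
  let P : ℚ := p
  let a : ℚ := P ^ (m - 1)
  let b : ℚ := P ^ ((m - 1) / 2)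
  let c : ℚ := P ^ ((m + 1) / 2)
  let Q : ℚ := P ^ m - 1
  [ (0, 1),
    (1 / 2 * (P - 1) * a, 2 * n0),
    (1 / 2 * (P - 1) * (a + b), 2 * nM),
    (1 / 2 * (P - 1) * (a - b), 2 * nP),
    ((P - 1) * (a - 1 / 2 * b), 2 * n0 * nP + 2 * Q * n0s * nP1),
    ((P - 1) * (a - 1 / 2 * c), 2 * Q * n0s * nP3),
    ((P - 1) * (a - b), nP ^ 2 + Q * nP1 ^ 2),
    ((P - 1) * (a - c), Q * nP3 ^ 2),
    ((P - 1) * (a + 1 / 2 * b), 2 * n0 * nM + 2 * Q * n0s * nM1),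
    ((P - 1) * (a + 1 / 2 * c), 2 * Q * n0s * nM3),
    ((P - 1) * (a + b), nM ^ 2 + Q * nM1 ^ 2),
    ((P - 1) * (a + c), Q * nM3 ^ 2),
    ((P - 1) * (a - 1 / 2 * b - 1 / 2 * c), 2 * Q * nP1 * nP3),
    ((P - 1) * (a - 1 / 2 * b + 1 / 2 * c), 2 * Q * nP1 * nM3),
    ((P - 1) * (a + 1 / 2 * b - 1 / 2 * c), 2 * Q * nM1 * nP3),
    ((P - 1) * (a + 1 / 2 * b + 1 / 2 * c), 2 * Q * nM1 * nM3),
    ((P - 1) * a, n0 ^ 2 + 2 * nP * nM + Q * n0s ^ 2 + 2 * Q * (nP1 * nM1 + nP3 * nM3)) ]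

/-- The total frequency that a table of rows (weight, frequency) assigns to the weight `i`: rows of
equal weight are added up, and a weight that does not occur gets `0`. -/
def tableFrequency (T : List (ℚ × ℚ)) (i : ℕ) : ℚ :=
  ((T.filter (fun r => r.1 = (i : ℚ))).map Prod.snd).sum

/-! ### Quadratic Gauss sums and exponential sums of quadratic forms -/

section GaussSums

/-! Put `q = p` and `σ(x) = x^(p^k)`. As `gcd(m,k) = 1`, the fixed field of `σ` is `𝔽_p`, and
`D(u,v,w)` is the sum over `y ≠ 0` of the exponential sums `S(y)` of `yQ`, where `Q(x) = Tr(u x² + v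
xσ(x) + w xσ²(x))`. Diagonalizing `Q` (`QuadraticForm.exists_rank_expSum`) shows that for odd rank
the sum over `y` cancels, while for even rank `r` every `S(y)` has the same value `e = ±q^(m-r/2)`.
The radical of a nonzero `Q` lies in the zero set of a nonzero `σ`-polynomial of order 4 (after a
shift, of order 2 if `w = 0`), so its dimension is at most 4 or 2 (`card_zeros_iterate_le`). As `m`
is odd, even rank means corank 1, or 3 if `w ≠ 0`. Hence `D = (q-1)e` with `e` in a list of at most
five values, apart from the zero form.

The counts come from the power moments of `e` over `(u,v)` for fixed `w` (`sum_pow_eq`). By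
orthogonality a moment counts the common zeros of the coefficients of `u` and `v`. Since `e` does
not depend on the multiplier, the factors may be chosen freely: one is the full sum over `y`, the
others are `S(1)` and `S(-1)`, whose product is the exponential sum of a hyperbolic form in `(s,t)`.
The fourth moment leads to `y z² - x² + 4st = 0` and its `σ`-twist. For `s ≠ 0` the substitution `x
= 2as`, `z = 2bs` reduces this to `(σa - a)² = y(σb - b)²`; if `b` is not fixed by `σ`, the
solutions are `a = db + c` with `d, c` in the ground field and `d² = y`. Such solutions also satisfy
the `σ²`-twist (`twisted_relation`), so the moments do not depend on `w`. Moments and total number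
of pairs form a linear system for the counts.

For the code, trace words `t ↦ Tr(∑ aᵢγᵢᵗ)` are split by the parity of `t`: the even and the odd
positions each evaluate one form on representatives of the nonzero elements modulo sign. The two
pairs `(u,v)` vary independently; only `w` is shared, up to a nonzero factor. The weight is affine
in the sum of the two values of `D` (`two_mul_card_mul_hammingNorm`), so the weight distribution is
a convolution of the value distributions. The zero form alone attains the maximal value of `D`, so
only the zero coefficients give the zero word, and a dimension count identifies the trace words with
the code (`dvd_and_eq_codeOfParityCheck`). -/

theorem AddChar.map_sum_finset {A M ι : Type*} [AddCommMonoid A] [CommMonoid M] (ψ : AddChar A M)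
    (s : Finset ι) (f : ι → A) : ψ (∑ i ∈ s, f i) = ∏ i ∈ s, ψ (f i) := by
  classical
  induction s using Finset.induction_on with
  | empty => simp
  | insert a s ha ih => rw [Finset.sum_insert ha, Finset.prod_insert ha, AddChar.map_add_eq_mul, ih]

variable {K : Type*} [Field K] [Fintype K] [DecidableEq K]

/-- The complex-valued quadratic character of a finite field. -/
noncomputable def complexQuadChar (K : Type*) [Field K] [Fintype K] [DecidableEq K] : MulChar K ℂ :=
  (quadraticChar K).ringHomComp (Int.castRingHom ℂ)

theorem complexQuadChar_apply (a : K) : complexQuadChar K a = (quadraticChar K a : ℂ) := rfl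

theorem complexQuadChar_ne_one (hK : ringChar K ≠ 2) : complexQuadChar K ≠ 1 := by
  rw [complexQuadChar, Ne, MulChar.ringHomComp_eq_one_iff (RingHom.injective_int _)]
  exact quadraticChar_ne_one hK

/-- An element `t` has `η(t) + 1` square roots, `η` being the quadratic character. The constant 1
contributes a full character sum, which vanishes, and `η(t)` a twisted Gauss sum. -/
theorem sum_addChar_mul_sq (hK : ringChar K ≠ 2) {χ : AddChar K ℂ} (hχ : χ.IsPrimitive)
    {a : K} (ha : a ≠ 0) :
    ∑ c : K, χ (a * c ^ 2) = complexQuadChar K a * gaussSum (complexQuadChar K) χ := by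
  have h1 : ∑ c : K, χ (a * c ^ 2) = ∑ t : K, ((quadraticChar K t : ℂ) + 1) * χ (a * t) := by
    rw [← Finset.sum_fiberwise (s := Finset.univ) (g := fun c : K => c ^ 2)]
    refine Finset.sum_congr rfl fun t _ => ?_
    have h2 := quadraticChar_card_sqrts hK t
    have h3 : (Finset.univ.filter fun c : K => c ^ 2 = t) = {x : K | x ^ 2 = t}.toFinset := by
      ext; simp
    rw [Finset.sum_congr rfl (g := fun _ => χ (a * t)), Finset.sum_const, h3, nsmul_eq_mul]
    · congr 1
      exact_mod_cast congrArg (Int.cast : ℤ → ℂ) h2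
    · intro c hc
      rw [(Finset.mem_filter.1 hc).2]
  have h4 : ∑ t : K, χ (a * t) = 0 := by
    have := AddChar.sum_mulShift a hχ
    simp only [ha, if_false, Nat.cast_zero] at this
    simpa [mul_comm] using this
  have h5 := gaussSum_mulShift (complexQuadChar K) χ (Units.mk0 a ha)
  have h6 : complexQuadChar K a * complexQuadChar K a = 1 := by
    rw [complexQuadChar_apply, ← Int.cast_mul, ← sq, quadraticChar_sq_one ha, Int.cast_one]
  have h7 : gaussSum (complexQuadChar K) (χ.mulShift a) = ∑ t : K, (quadraticChar K t : ℂ) * χ (a * t) := by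
    simp [gaussSum, complexQuadChar_apply, AddChar.mulShift_apply]
  rw [h1]
  simp only [add_mul, one_mul, Finset.sum_add_distrib, h4, add_zero, ← h7]
  rw [← h5, Units.val_mk0, ← mul_assoc, h6, one_mul]

theorem sum_complexQuadChar (hK : ringChar K ≠ 2) : ∑ y : Kˣ, complexQuadChar K y = 0 := by
  have h := MulChar.sum_eq_zero_of_ne_one (complexQuadChar_ne_one hK)
  rw [← h, ← Finset.sum_subset (Finset.subset_univ (Finset.univ.image (Units.val : Kˣ → K)))]
  · rw [Finset.sum_image fun _ _ _ _ h => Units.ext h]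
  · intro x _ hx
    apply MulChar.map_nonunit
    rintro ⟨u, rfl⟩
    exact hx (Finset.mem_image_of_mem _ (Finset.mem_univ u))

/-- The square of the Gauss sum is `η(-1)|K|`. Even powers suffice, because odd ranks cancel in the
sum over multipliers. -/
theorem exists_sign_gaussSum_pow (hK : ringChar K ≠ 2) {χ : AddChar K ℂ} (hχ : χ.IsPrimitive)
    (s : ℕ) : ∃ ε : ℤ, (ε = 1 ∨ ε = -1) ∧
      gaussSum (complexQuadChar K) χ ^ (s + s) = ε * (Fintype.card K : ℂ) ^ s := by
  have hq : (complexQuadChar K).IsQuadratic := (quadraticChar_isQuadratic K).comp _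
  refine ⟨quadraticChar K (-1) ^ s, ?_, ?_⟩
  · rcases quadraticChar_dichotomy (F := K) (neg_ne_zero.2 one_ne_zero) with h | h <;> rw [h]
    · simp
    · exact neg_one_pow_eq_or ℤ s
  · rw [← two_mul, pow_mul, gaussSum_sq (complexQuadChar_ne_one hK) hq hχ, mul_pow,
      complexQuadChar_apply]
    push_cast
    rfl

variable {V : Type*} [AddCommGroup V] [Module K V] [Fintype V] [FiniteDimensional K V]

/-- Exponential sums of a quadratic form of rank `r`. -/
theorem QuadraticForm.exists_rank_expSum (hK : ringChar K ≠ 2) {χ : AddChar K ℂ}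
    (hχ : χ.IsPrimitive) (Q : QuadraticForm K V) :
    ∃ r ≤ Module.finrank K V,
      Fintype.card K ^ (Module.finrank K V - r) ≤ Nat.card {z : V // ∀ x, Q (x + z) = Q x} ∧
      (Odd r → ∑ y : Kˣ, ∑ x : V, χ (y * Q x) = 0) ∧
      (Even r → ∃ ε : ℤ, (ε = 1 ∨ ε = -1) ∧ ∀ y : Kˣ,
        ∑ x : V, χ (y * Q x) = ε * (Fintype.card K : ℂ) ^ (Module.finrank K V - r / 2)) := by
  have h2 : (2 : K) ≠ 0 := Ring.two_ne_zero hK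
  let _ : Invertible (2 : K) := invertibleOfNonzero h2
  obtain ⟨w, ⟨e⟩⟩ := Q.equivalent_weightedSumSquares
  generalize Module.finrank K V = n at w e ⊢
  -- The rank is `|S|`: an index in `S` contributes a Gauss sum twisted by `η(y wᵢ)`, any other
  -- index the factor `|K|`.
  set S : Finset (Fin n) := Finset.univ.filter fun i => w i ≠ 0 with hS
  have hSn : S.card ≤ n := by simpa using S.card_le_univ
  have hQ : ∀ x : Fin n → K, Q (e.symm x) = ∑ i, w i * x i ^ 2 := by
    intro x
    rw [e.symm.map_app]
    simp only [QuadraticMap.weightedSumSquares_apply, sq, smul_eq_mul]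
  have hG : ∀ y : Kˣ, ∑ x : V, χ (y * Q x) =
      complexQuadChar K y ^ S.card * ((∏ i ∈ S, complexQuadChar K (w i)) *
        (gaussSum (complexQuadChar K) χ ^ S.card * (Fintype.card K : ℂ) ^ (n - S.card))) := by
    intro y
    rw [← Equiv.sum_comp e.symm.toLinearEquiv.toEquiv]
    have h1 : ∀ x : Fin n → K, χ (y * Q (e.symm x)) = ∏ i, χ (y * w i * x i ^ 2) := by
      intro x
      rw [hQ, Finset.mul_sum, AddChar.map_sum_finset]
      simp only [mul_assoc]
    change ∑ x : Fin n → K, χ (y * Q (e.symm x)) = _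
    simp only [h1]
    rw [← Fintype.piFinset_univ, ← Finset.prod_univ_sum (fun _ => Finset.univ)
      (fun i c => χ (y * w i * c ^ 2)), ← Finset.prod_mul_prod_compl S]
    have hA : ∏ i ∈ S, ∑ c : K, χ (y * w i * c ^ 2) =
        ∏ i ∈ S, complexQuadChar K y * (complexQuadChar K (w i) *
          gaussSum (complexQuadChar K) χ) := by
      refine Finset.prod_congr rfl fun i hi => ?_
      rw [sum_addChar_mul_sq hK hχ (mul_ne_zero y.ne_zero (Finset.mem_filter.1 hi).2), map_mul,
        mul_assoc]
    have hB : ∏ i ∈ Sᶜ, ∑ c : K, χ (y * w i * c ^ 2) = ∏ i ∈ Sᶜ, (Fintype.card K : ℂ) := by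
      refine Finset.prod_congr rfl fun i hi => ?_
      have : w i = 0 := by simpa [hS] using hi
      simp [this]
    rw [hA, hB]
    simp only [Finset.prod_mul_distrib, Finset.prod_const, Finset.card_compl, Fintype.card_fin]
    ring
  refine ⟨S.card, hSn, ?_, ?_, ?_⟩
  · have hc : Fintype.card K ^ (n - S.card) = Nat.card ({i // i ∉ S} → K) := by
      rw [Nat.card_fun, Nat.card_eq_fintype_card, Nat.card_eq_fintype_card]
      congr 1
      rw [Fintype.card_subtype_compl]
      simp
    rw [hc]
    -- Vectors supported off `S` in the diagonal coordinates can be added without changing `Q`.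
    refine Nat.card_le_card_of_injective
      (fun f => ⟨e.symm (fun i => if h : i ∉ S then f ⟨i, h⟩ else 0), ?_⟩) ?_
    · intro x
      obtain ⟨x, rfl⟩ := e.symm.toLinearEquiv.surjective x
      change Q (e.symm x + e.symm _) = Q (e.symm x)
      rw [← map_add, hQ, hQ]
      refine Finset.sum_congr rfl fun i _ => ?_
      by_cases hi : w i = 0
      · simp [hi]
      · have : i ∈ S := by simp [hS, hi]
        simp [this]
    · intro f g hfg
      have h := e.symm.toLinearEquiv.injective (Subtype.ext_iff.1 hfg)
      funext i
      have := congrFun h i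
      simpa [i.2] using this
  · intro hr
    simp only [hG]
    rw [← Finset.sum_mul]
    -- An odd power of `η(y)` is `η(y)`, which sums to zero over `Kˣ`; below, an even power is 1 and
    -- the dependence on `y` disappears.
    have : ∀ y : Kˣ, complexQuadChar K y ^ S.card = complexQuadChar K y := by
      intro y
      obtain ⟨s, hs⟩ := hr
      rw [hs, pow_succ, pow_mul, complexQuadChar_apply, ← Int.cast_pow,
        quadraticChar_sq_one y.ne_zero]
      simp
    simp only [this, sum_complexQuadChar hK, zero_mul]
  · rintro ⟨s, hs⟩
    obtain ⟨ε, hε, hg⟩ := exists_sign_gaussSum_pow hK hχ s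
    have hP : ∃ δ : ℤ, (δ = 1 ∨ δ = -1) ∧ ∏ i ∈ S, complexQuadChar K (w i) = δ := by
      refine ⟨∏ i ∈ S, quadraticChar K (w i), ?_, ?_⟩
      · refine Finset.prod_induction _ (fun z : ℤ => z = 1 ∨ z = -1) ?_ (Or.inl rfl) ?_
        · rintro a b (rfl | rfl) (rfl | rfl) <;> simp
        · exact fun i hi => quadraticChar_dichotomy (Finset.mem_filter.1 hi).2
      · simp [complexQuadChar_apply]
    obtain ⟨δ, hδ, hP⟩ := hP
    refine ⟨δ * ε, ?_, ?_⟩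
    · rcases hδ with rfl | rfl <;> rcases hε with rfl | rfl <;> simp
    · intro y
      have hy : complexQuadChar K y ^ S.card = 1 := by
        rw [hs, ← two_mul, pow_mul, complexQuadChar_apply, ← Int.cast_pow,
          quadraticChar_sq_one y.ne_zero]
        simp
      rw [hG, hy, hP, hs, hg]
      have h1 : n - (s + s) / 2 = s + (n - (s + s)) := by omega
      rw [h1, pow_add]
      push_cast
      ring

end GaussSums

/-! ### Zeros of σ-polynomials -/

section LinearizedPolynomials

variable {K F : Type*} [Field K] [Fintype K] [Field F] [Fintype F] [Algebra K F]

/-- Abel summation. When the `e j` sum to zero, it factors the operator `∑ eⱼσʲ` through `σ - 1`. -/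
theorem sum_range_mul_eq_sum_range_mul_sub {R : Type*} [CommRing R] (e a : ℕ → R) (n : ℕ) :
    ∑ j ∈ Finset.range (n + 1), e j * a j =
      ∑ j ∈ Finset.range n, (-∑ i ∈ Finset.range (j + 1), e i) * (a (j + 1) - a j) +
        (∑ i ∈ Finset.range (n + 1), e i) * a n := by
  induction n with
  | zero => simp
  | succ n ih =>
    rw [Finset.sum_range_succ, ih, Finset.sum_range_succ (fun j => (-_) * _),
      Finset.sum_range_succ e (n + 1)]
    ring

open Classical in
/-- A nonzero operator `∑ cⱼ σʲ` of order at most `d`, where `σ` has fixed field `K`, has at most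
`|K|ᵈ` zeros. -/
theorem card_zeros_iterate_le (σ : F ≃ₐ[K] F)
    (hfix : ∀ x, σ x = x → ∃ c : K, algebraMap K F c = x) (d : ℕ) (c : ℕ → F)
    (hc : ∃ j ≤ d, c j ≠ 0) :
    (Finset.univ.filter fun x => ∑ j ∈ Finset.range (d + 1), c j * σ^[j] x = 0).card ≤
      Fintype.card K ^ d := by
  induction d generalizing c with
  | zero =>
    obtain ⟨j, hj, hcj⟩ := hc
    obtain rfl : j = 0 := by omega
    rw [pow_zero, Finset.card_le_one]
    intro a ha b hb
    simp [hcj] at ha hb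
    rw [ha, hb]
  | succ d ih =>
    set Z := Finset.univ.filter fun x => ∑ j ∈ Finset.range (d + 1 + 1), c j * σ^[j] x = 0
    by_cases hZ : ∃ x ∈ Z, x ≠ 0
    swap
    · push Not at hZ
      refine (Finset.card_le_one.2 fun a ha b hb => (hZ a ha).trans (hZ b hb).symm).trans ?_
      exact Nat.one_le_pow _ _ Fintype.card_pos
    obtain ⟨x₀, hx₀, hne⟩ := hZ
    have hpow : ∀ (j : ℕ) (x y : F), σ^[j] (x * y) = σ^[j] x * σ^[j] y := fun j x y => by
      simp only [← AlgEquiv.coe_pow, map_mul]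
    have hpow0 : ∀ (j : ℕ) (x : F), σ^[j] x = 0 ↔ x = 0 := fun j x => by
      simp only [← AlgEquiv.coe_pow, map_eq_zero]
    have hpows : ∀ (j : ℕ) (x y : F), σ^[j] (x - y) = σ^[j] x - σ^[j] y := fun j x y => by
      simp only [← AlgEquiv.coe_pow, map_sub]
    -- Reduction of order: substituting `x = x₀ · t` gives the operator `∑ eⱼσʲ`, which kills 1
    -- because `x₀` is a zero. It therefore factors through `σ - 1`, leaving an operator of order
    -- `d` with coefficients `f`. These are not all zero, as otherwise every `e j`, hence every `c
    -- j`, would vanish.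
    set e : ℕ → F := fun j => c j * σ^[j] x₀ with he
    have hsum : ∑ j ∈ Finset.range (d + 1 + 1), e j = 0 := (Finset.mem_filter.1 hx₀).2
    set f : ℕ → F := fun j => -∑ i ∈ Finset.range (j + 1), e i with hf
    have hfne : ∃ j ≤ d, f j ≠ 0 := by
      by_contra! h
      have h0 : ∀ j ≤ d + 1, ∑ i ∈ Finset.range (j + 1), e i = 0 := by
        intro j hj
        rcases Nat.lt_or_ge d j with h1 | h1
        · obtain rfl : j = d + 1 := by omega
          exact hsum
        · exact neg_eq_zero.1 (h j h1)
      obtain ⟨j, hj, hcj⟩ := hc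
      have : e j = 0 := by
        have h1 := h0 j hj
        rw [Finset.sum_range_succ] at h1
        rcases j with _ | j
        · simpa using h1
        · rwa [h0 j (by omega), zero_add] at h1
      rcases mul_eq_zero.1 this with h1 | h1
      · exact hcj h1
      · exact hne ((hpow0 j x₀).1 h1)
    set g : F → F := fun x => σ (x / x₀) - x / x₀ with hg
    have himg : Z.image g ⊆
        Finset.univ.filter fun x => ∑ j ∈ Finset.range (d + 1), f j * σ^[j] x = 0 := by
      intro y hy
      obtain ⟨x, hx, rfl⟩ := Finset.mem_image.1 hy
      have h1 : ∑ j ∈ Finset.range (d + 1 + 1), e j * σ^[j] (x / x₀) = 0 := by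
        rw [← (Finset.mem_filter.1 hx).2]
        refine Finset.sum_congr rfl fun j _ => ?_
        rw [he]
        dsimp only
        rw [mul_assoc, ← hpow, mul_div_cancel₀ _ hne]
      rw [sum_range_mul_eq_sum_range_mul_sub e (fun j => σ^[j] (x / x₀)), hsum, zero_mul,
        add_zero] at h1
      refine Finset.mem_filter.2 ⟨Finset.mem_univ _, ?_⟩
      rw [← h1]
      refine Finset.sum_congr rfl fun j _ => ?_
      rw [hg]
      dsimp only
      rw [hpows, Function.iterate_succ_apply]
    -- Two points of a fibre of `g` have quotients by `x₀` differing by a fixed element of `σ`, that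
    -- is, by an element of `K`.
    have hfib : ∀ a ∈ Z.image g, (Z.filter fun x => g x = a).card ≤ Fintype.card K := by
      intro a ha
      obtain ⟨x₁, hx₁, rfl⟩ := Finset.mem_image.1 ha
      refine (Finset.card_le_card (t := Finset.univ.image
        fun t : K => (x₁ / x₀ + algebraMap K F t) * x₀) ?_).trans Finset.card_image_le
      intro x hx
      have h1 : g x = g x₁ := (Finset.mem_filter.1 hx).2
      obtain ⟨t, ht⟩ := hfix (x / x₀ - x₁ / x₀) (by
        rw [map_sub]
        linear_combination h1)
      refine Finset.mem_image.2 ⟨t, Finset.mem_univ _, ?_⟩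
      rw [ht, add_sub_cancel, div_mul_cancel₀ _ hne]
    calc Z.card ≤ Fintype.card K * (Z.image g).card := Finset.card_le_mul_card_image _ _ hfib
      _ ≤ Fintype.card K * Fintype.card K ^ d :=
        Nat.mul_le_mul_left _ ((Finset.card_le_card himg).trans (ih f hfne))
      _ = Fintype.card K ^ (d + 1) := by ring

end LinearizedPolynomials

/-! ### The quadratic forms and their radicals -/

section TwistedForms

variable {K F : Type*} [Field K] [Fintype K] [Field F] [Fintype F] [Algebra K F]

/-- The bilinear form `Tr(u x y + v x σ(y) + w x σ²(y))`. -/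
noncomputable def twistedBilin (σ : F ≃ₐ[K] F) (u v w : F) : LinearMap.BilinMap K F K :=
  LinearMap.mk₂ K
    (fun x y => Algebra.trace K F (u * (x * y) + v * (x * σ y) + w * (x * σ (σ y))))
    (fun x x' y => by rw [← map_add]; congr 1; ring)
    (fun c x y => by
      rw [← map_smul]; congr 1
      simp only [Algebra.smul_def]; ring)
    (fun x y y' => by rw [← map_add]; congr 1; simp only [map_add]; ring)
    (fun c x y => by
      rw [← map_smul]; congr 1
      simp only [Algebra.smul_def, map_mul, AlgEquiv.commutes]; ring)

/-- The quadratic form `Tr(u x² + v x σ(x) + w x σ²(x))`. -/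
noncomputable def twistedForm (σ : F ≃ₐ[K] F) (u v w : F) : QuadraticForm K F :=
  (twistedBilin σ u v w).toQuadraticMap

omit [Fintype K] [Fintype F] in
theorem twistedForm_apply (σ : F ≃ₐ[K] F) (u v w x : F) : twistedForm σ u v w x =
    Algebra.trace K F (u * (x * x) + v * (x * σ x) + w * (x * σ (σ x))) := rfl

variable [FiniteDimensional K F] [Algebra.IsSeparable K F]

omit [Fintype K] [Fintype F] in
-- After polarization, each trace term is moved by a power of `σ` until `x` occurs only as `σ²(x)`.
-- Nondegeneracy of the trace form then forces the coefficient of `σ²(x)` to vanish.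
theorem twistedForm_radical (σ : F ≃ₐ[K] F) (u v w z : F)
    (hz : ∀ x, twistedForm σ u v w (x + z) = twistedForm σ u v w x) :
    w * z + σ v * σ z + 2 * σ (σ u) * σ (σ z) + σ (σ v) * σ (σ (σ z)) +
      σ (σ w) * σ (σ (σ (σ z))) = 0 := by
  have htr : ∀ x, Algebra.trace K F (σ x) = Algebra.trace K F x := Algebra.trace_eq_of_algEquiv σ
  have hz0 : twistedForm σ u v w z = 0 := by simpa using hz 0
  apply (traceForm_nondegenerate K F).1
  intro y
  obtain ⟨x, rfl⟩ := σ.surjective y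
  obtain ⟨x, rfl⟩ := σ.surjective x
  rw [Algebra.traceForm_apply]
  have h := hz x
  have h1 : twistedForm σ u v w (x + z) = twistedForm σ u v w x + twistedForm σ u v w z +
      (Algebra.trace K F (2 * u * x * z) + Algebra.trace K F (v * (x * σ z)) +
        Algebra.trace K F (v * (z * σ x)) + Algebra.trace K F (w * (x * σ (σ z))) +
        Algebra.trace K F (w * (z * σ (σ x)))) := by
    simp only [twistedForm_apply, ← map_add]
    congr 1
    simp only [map_add]
    ring
  rw [h1, hz0, add_zero, add_eq_left] at h
  rw [← h, ← htr (2 * u * x * z), ← htr (σ (2 * u * x * z)), ← htr (v * (x * σ z)),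
    ← htr (σ (v * (x * σ z))), ← htr (v * (z * σ x)), ← htr (w * (x * σ (σ z))),
    ← htr (σ (w * (x * σ (σ z))))]
  simp only [← map_add]
  congr 1
  simp only [map_add, map_mul, map_ofNat]
  ring

theorem card_twistedForm_radical_le [DecidableEq F] (hK : ringChar K ≠ 2) (σ : F ≃ₐ[K] F)
    (hfix : ∀ x, σ x = x → ∃ c : K, algebraMap K F c = x) {u v w : F}
    (h : ¬(u = 0 ∧ v = 0 ∧ w = 0)) :
    Nat.card {z : F // ∀ x, twistedForm σ u v w (x + z) = twistedForm σ u v w x} ≤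
      Fintype.card K ^ (if w = 0 then 2 else 4) := by
  have h2 : (2 : F) ≠ 0 := by
    have : (2 : K) ≠ 0 := Ring.two_ne_zero hK
    rw [← map_ofNat (algebraMap K F) 2]
    exact (_root_.map_ne_zero _).2 this
  classical
  rw [Nat.card_eq_fintype_card, Fintype.card_subtype]
  split_ifs with hw
  · subst hw
    set c : ℕ → F := fun j => if j = 0 then σ v else if j = 1 then 2 * σ (σ u) else σ (σ v)
    -- For `w = 0` the outer terms drop out, and the rest is an operator of order 2 evaluated at
    -- `σ(z)`.
    refine le_trans ?_ (card_zeros_iterate_le σ hfix 2 c ?_)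
    · refine Finset.card_le_card_of_injOn σ ?_ σ.injective.injOn
      intro z hz
      have := twistedForm_radical σ u v 0 z (Finset.mem_filter.1 hz).2
      simp only [Finset.coe_filter, Finset.mem_univ, true_and, Set.mem_ofPred_eq]
      rw [← this]
      simp [Finset.sum_range_succ, c]
    · by_cases hv : v = 0
      · refine ⟨1, by norm_num, ?_⟩
        have : u ≠ 0 := fun hu => h ⟨hu, hv, rfl⟩
        simp [c, h2, this]
      · exact ⟨0, by norm_num, by simp [c, hv]⟩
  · set c : ℕ → F := fun j => if j = 0 then w else if j = 1 then σ v else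
      if j = 2 then 2 * σ (σ u) else if j = 3 then σ (σ v) else σ (σ w)
    refine le_trans ?_ (card_zeros_iterate_le σ hfix 4 c ⟨0, by norm_num, by simpa [c] using hw⟩)
    refine Finset.card_le_card fun z hz => ?_
    have := twistedForm_radical σ u v w z (Finset.mem_filter.1 hz).2
    simp only [Finset.mem_filter, Finset.mem_univ, true_and]
    rw [← this]
    simp [Finset.sum_range_succ, c]

end TwistedForms

/-! ### Counting solutions of the moment equations -/

section Counting

variable {K F : Type*} [Field K] [Fintype K] [DecidableEq K] [Field F] [Fintype F] [DecidableEq F]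
  [Algebra K F]

omit [Fintype K] [Fintype F] [DecidableEq K] [DecidableEq F] in
-- From `σ(r)² = r²` follows `σ(r) = ±r`; the minus sign leaves only `r = 0`.
theorem exists_algebraMap_eq_of_sq {σ : F ≃ₐ[K] F}
    (hfix : ∀ x, σ x = x → ∃ c : K, algebraMap K F c = x) (hneg : ∀ x, σ x = -x → x = 0)
    {r : F} {y : K} (h : r ^ 2 = algebraMap K F y) : ∃ d : K, algebraMap K F d = r ∧ d ^ 2 = y := by
  have h1 : (σ r) ^ 2 = r ^ 2 := by rw [← map_pow, h, AlgEquiv.commutes]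
  have h2 : ∃ d : K, algebraMap K F d = r := by
    rcases sq_eq_sq_iff_eq_or_eq_neg.1 h1 with h2 | h2
    · exact hfix r h2
    · exact ⟨0, by rw [hneg r h2, map_zero]⟩
  obtain ⟨d, rfl⟩ := h2
  exact ⟨d, rfl, (algebraMap K F).injective (by rw [map_pow, h])⟩

omit [Fintype K] [Fintype F] [DecidableEq K] [DecidableEq F] in
theorem exists_of_sq_eq_mul_sq {σ : F ≃ₐ[K] F}
    (hfix : ∀ x, σ x = x → ∃ c : K, algebraMap K F c = x) (hneg : ∀ x, σ x = -x → x = 0)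
    {x z : F} {y : K} (hz : z ≠ 0) (h : x ^ 2 = algebraMap K F y * z ^ 2) :
    ∃ d : K, d ^ 2 = y ∧ x = algebraMap K F d * z := by
  obtain ⟨d, hd, hdy⟩ := exists_algebraMap_eq_of_sq hfix hneg (r := x / z) (y := y) (by
    rw [div_pow, h, mul_div_cancel_right₀ _ (pow_ne_zero 2 hz)])
  exact ⟨d, hdy, by rw [hd, div_mul_cancel₀ _ hz]⟩

omit [Fintype K] [Fintype F] [DecidableEq K] [DecidableEq F] in
-- The previous lemma gives `σa - a = d(σb - b)`, so `a - db` is fixed by `σ`.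
theorem exists_of_sub_sq_eq_mul_sub_sq {σ : F ≃ₐ[K] F}
    (hfix : ∀ x, σ x = x → ∃ c : K, algebraMap K F c = x) (hneg : ∀ x, σ x = -x → x = 0)
    {a b : F} {y : K} (hb : σ b ≠ b) (h : (σ a - a) ^ 2 = algebraMap K F y * (σ b - b) ^ 2) :
    ∃ d c : K, d ^ 2 = y ∧ a = algebraMap K F d * b + algebraMap K F c := by
  obtain ⟨d, hd, hda⟩ := exists_of_sq_eq_mul_sq hfix hneg (sub_ne_zero.2 hb) h
  obtain ⟨c, hc⟩ := hfix (a - algebraMap K F d * b) (by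
    rw [map_sub, map_mul, AlgEquiv.commutes]
    linear_combination hda)
  exact ⟨d, c, hd, by rw [hc]; ring⟩

/-- For a single `y` the count depends on whether `y` is a square. Letting `y` vary makes it
uniform: for `z ≠ 0` the solutions are `(d², dz)` with `d ∈ Kˣ`, and for `z = 0` they are `(y, 0)`.
The second equation is then automatic. -/
theorem card_sq_eq_mul_sq {σ : F ≃ₐ[K] F}
    (hfix : ∀ x, σ x = x → ∃ c : K, algebraMap K F c = x) (hneg : ∀ x, σ x = -x → x = 0) (z : F) :
    (Finset.univ.filter fun τ : Kˣ × F => algebraMap K F τ.1 * (z * z) - τ.2 * τ.2 = 0 ∧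
      algebraMap K F τ.1 * (z * σ z) - τ.2 * σ τ.2 = 0).card = Fintype.card Kˣ := by
  by_cases hz : z = 0
  · rw [← Finset.card_univ, ← Finset.card_image_of_injective (f := fun y : Kˣ => (y, (0 : F)))
      Finset.univ (fun a b h => (Prod.ext_iff.1 h).1)]
    congr 1
    ext ⟨y, x⟩
    simp [hz, eq_comm]
    grind
  · rw [← Finset.card_univ, ← Finset.card_image_of_injective
      (f := fun y : Kˣ => (y ^ 2, algebraMap K F y * z)) Finset.univ]
    · congr 1
      ext ⟨y, x⟩
      simp only [Finset.mem_filter, Finset.mem_univ, true_and, Finset.mem_image, Prod.mk.injEq]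
      constructor
      · rintro ⟨h, -⟩
        obtain ⟨d, hd, hx⟩ := exists_of_sq_eq_mul_sq hfix hneg (x := x) (y := y) hz
          (by linear_combination -h)
        have hd0 : d ≠ 0 := by
          rintro rfl
          exact y.ne_zero (by rw [← hd]; simp)
        exact ⟨Units.mk0 d hd0, Units.ext (by simpa using hd), hx.symm⟩
      · rintro ⟨d, rfl, rfl⟩
        simp only [Units.val_pow_eq_pow_val, map_pow, map_mul, AlgEquiv.commutes]
        constructor <;> ring
    · intro a b h
      have := mul_right_cancel₀ hz (Prod.ext_iff.1 h).2
      exact Units.ext ((algebraMap K F).injective this)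

/-- Averaging over `y` again makes the count independent of `b`: if `σb = b` then `a ∈ K` and `y` is
free; otherwise the solutions are `(d², db + c)`, and `(d, c)` can be recovered since `b` is not
fixed. -/
theorem card_sub_sq_eq_mul_sub_sq {σ : F ≃ₐ[K] F}
    (hfix : ∀ x, σ x = x → ∃ c : K, algebraMap K F c = x) (hneg : ∀ x, σ x = -x → x = 0) (b : F) :
    (Finset.univ.filter fun τ : Kˣ × F =>
      (σ τ.2 - τ.2) ^ 2 = algebraMap K F τ.1 * (σ b - b) ^ 2).card =
      Fintype.card Kˣ * Fintype.card K := by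
  rw [← Fintype.card_prod, ← Finset.card_univ]
  by_cases hb : σ b = b
  · rw [← Finset.card_image_of_injective (f := fun τ : Kˣ × K => (τ.1, algebraMap K F τ.2))]
    · congr 1
      ext ⟨y, a⟩
      simp only [Finset.mem_filter, Finset.mem_univ, true_and, Finset.mem_image, Prod.mk.injEq,
        hb, sub_self, Prod.exists]
      constructor
      · intro h
        obtain ⟨c, hc⟩ := hfix a (by simpa [sub_eq_zero] using h)
        exact ⟨y, c, rfl, hc⟩
      · rintro ⟨y, c, rfl, rfl⟩
        simp
    · rintro ⟨y, c⟩ ⟨y', c'⟩ h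
      simpa using h
  · rw [← Finset.card_image_of_injective
      (f := fun τ : Kˣ × K => (τ.1 ^ 2, algebraMap K F τ.1 * b + algebraMap K F τ.2))]
    · congr 1
      ext ⟨y, a⟩
      simp only [Finset.mem_filter, Finset.mem_univ, true_and, Finset.mem_image, Prod.mk.injEq,
        Prod.exists]
      constructor
      · intro h
        obtain ⟨d, c, hd, ha⟩ := exists_of_sub_sq_eq_mul_sub_sq hfix hneg hb h
        have hd0 : d ≠ 0 := by
          rintro rfl
          exact y.ne_zero (by rw [← hd]; simp)
        exact ⟨Units.mk0 d hd0, c, Units.ext (by simpa using hd), ha.symm⟩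
      · rintro ⟨d, c, rfl, rfl⟩
        simp only [Units.val_pow_eq_pow_val, map_pow, map_mul, map_add, AlgEquiv.commutes]
        ring
    · rintro ⟨y, c⟩ ⟨y', c'⟩ h
      have h1 := (Prod.ext_iff.1 h).2
      dsimp only at h1
      have h2 := congrArg σ h1
      simp only [map_add, map_mul, AlgEquiv.commutes] at h2
      have h3 : (algebraMap K F y - algebraMap K F y') * (σ b - b) = 0 := by
        linear_combination h2 - h1
      have h4 : y = y' := by
        rcases mul_eq_zero.1 h3 with h | h
        · exact Units.ext ((algebraMap K F).injective (sub_eq_zero.1 h))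
        · exact absurd (sub_eq_zero.1 h) hb
      subst h4
      simpa using h1

omit [Fintype K] [DecidableEq K] [Fintype F] [DecidableEq F] in
/-- If the two symmetric relations hold for `1` and `σ`, then also for `σ²`. -/
theorem twisted_relation {σ : F ≃ₐ[K] F} (h2 : (2 : F) ≠ 0)
    (hfix : ∀ x, σ x = x → ∃ c : K, algebraMap K F c = x) (hneg : ∀ x, σ x = -x → x = 0)
    {y : K} {z x s t : F}
    (hα : algebraMap K F y * (z * z) - x * x + 4 * (s * t) = 0)
    (hβ : algebraMap K F y * (z * σ z) - x * σ x + 2 * (s * σ t + t * σ s) = 0) :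
    algebraMap K F y * (z * σ (σ z)) - x * σ (σ x) + 2 * (s * σ (σ t) + t * σ (σ s)) = 0 := by
  by_cases hs : s = 0
  · subst hs
    by_cases hz : z = 0
    · subst hz
      have : x = 0 := by simpa using hα
      simp [this]
    · obtain ⟨d, hd, rfl⟩ := exists_of_sq_eq_mul_sq hfix hneg (x := x) (y := y) hz
        (by linear_combination -hα)
      simp only [← hd, map_mul, map_pow, AlgEquiv.commutes, map_zero]
      ring
  -- In the coordinates `a, b` the relation for any power `τ` of `σ` reads `2sτ(s)((τa - a)² - y(τb
  -- - b)²) = 0`. For `τ = σ` it makes `a` and `b` both fixed, or gives `a = db + c` with `d² = y`;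
  -- either solves the relation for `τ = σ²`.
  · obtain ⟨a, rfl⟩ : ∃ a, x = 2 * a * s := ⟨x / (2 * s), by field_simp⟩
    obtain ⟨b, rfl⟩ : ∃ b, z = 2 * b * s := ⟨z / (2 * s), by field_simp⟩
    have ht : t = (a ^ 2 - algebraMap K F y * b ^ 2) * s := by
      have h4 : 2 * 2 * s ≠ 0 := mul_ne_zero (mul_ne_zero h2 h2) hs
      apply mul_left_cancel₀ h4
      linear_combination hα
    subst ht
    have h1 : (σ a - a) ^ 2 = algebraMap K F y * (σ b - b) ^ 2 := by
      have h4 : 2 * s * σ s ≠ 0 :=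
        mul_ne_zero (mul_ne_zero h2 hs) ((_root_.map_ne_zero σ).2 hs)
      apply mul_left_cancel₀ h4
      simp only [map_mul, map_sub, map_pow, AlgEquiv.commutes, map_ofNat] at hβ
      linear_combination hβ
    simp only [map_mul, map_sub, map_pow, AlgEquiv.commutes, map_ofNat]
    suffices h : (σ (σ a) - a) ^ 2 = algebraMap K F y * (σ (σ b) - b) ^ 2 by
      linear_combination 2 * s * σ (σ s) * h
    by_cases hb : σ b = b
    · have ha : σ a = a := by simpa [hb, sub_eq_zero] using h1
      simp [ha, hb]
    · obtain ⟨d, c, hd, rfl⟩ := exists_of_sub_sq_eq_mul_sub_sq hfix hneg hb h1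
      simp only [← hd, map_mul, map_add, map_pow, AlgEquiv.commutes]
      ring

omit [DecidableEq K] in
-- For `s ≠ 0` put `z = 2bs`; the first equation determines `t`, and the second becomes `y(σb - b)²
-- = 0`, so `b` runs through `K`. For `s = 0` it follows that `z = 0`, and `t` is free.
theorem card_triple_relation {σ : F ≃ₐ[K] F} (h2 : (2 : F) ≠ 0)
    (hfix : ∀ x, σ x = x → ∃ c : K, algebraMap K F c = x) (y : Kˣ) (s : F) :
    (Finset.univ.filter fun τ : F × F =>
      algebraMap K F y * (τ.1 * τ.1) + 4 * (s * τ.2) = 0 ∧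
      algebraMap K F y * (τ.1 * σ τ.1) + 2 * (s * σ τ.2 + τ.2 * σ s) = 0).card =
      if s = 0 then Fintype.card F else Fintype.card K := by
  have hy : algebraMap K F y ≠ 0 := (_root_.map_ne_zero _).2 y.ne_zero
  split_ifs with hs
  · rw [← Finset.card_univ, ← Finset.card_image_of_injective (f := fun t : F => ((0 : F), t))
      Finset.univ (fun a b h => (Prod.ext_iff.1 h).2)]
    congr 1
    ext ⟨z, t⟩
    simp [hs, eq_comm]
    grind
  · have h4 : 2 * 2 * s ≠ 0 := mul_ne_zero (mul_ne_zero h2 h2) hs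
    have h4' : 2 * s * σ s ≠ 0 := mul_ne_zero (mul_ne_zero h2 hs) ((_root_.map_ne_zero σ).2 hs)
    rw [← Finset.card_univ, ← Finset.card_image_of_injective
      (f := fun c : K => (2 * algebraMap K F c * s, -algebraMap K F y * algebraMap K F c ^ 2 * s))
      Finset.univ]
    · congr 1
      ext ⟨z, t⟩
      simp only [Finset.mem_filter, Finset.mem_univ, true_and, Finset.mem_image, Prod.mk.injEq]
      constructor
      · rintro ⟨hα, hβ⟩
        obtain ⟨b, rfl⟩ : ∃ b, z = 2 * b * s := ⟨z / (2 * s), by field_simp⟩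
        have ht : t = -algebraMap K F y * b ^ 2 * s := by
          apply mul_left_cancel₀ h4
          linear_combination hα
        subst ht
        have h1 : algebraMap K F y * (σ b - b) ^ 2 = 0 := by
          apply mul_left_cancel₀ h4'
          simp only [map_mul, map_neg, map_pow, AlgEquiv.commutes, map_ofNat] at hβ
          linear_combination -hβ
        obtain ⟨c, rfl⟩ := hfix b (by simpa [hy, sub_eq_zero] using h1)
        exact ⟨c, rfl, rfl⟩
      · rintro ⟨c, rfl, rfl⟩
        simp only [map_mul, map_neg, map_pow, AlgEquiv.commutes, map_ofNat]
        constructor <;> ring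
    · intro c c' h
      have h1 := mul_right_cancel₀ hs (Prod.ext_iff.1 h).1
      exact (algebraMap K F).injective (mul_left_cancel₀ h2 h1)

/-- For `s = 0` the element `t` is free and `card_sq_eq_mul_sq` applies to each `z`. For `s ≠ 0`
division by `2s` reduces the system to `card_sub_sq_eq_mul_sub_sq`, with `t` determined. -/
theorem card_quadruple_relation {σ : F ≃ₐ[K] F} (h2 : (2 : F) ≠ 0)
    (hfix : ∀ x, σ x = x → ∃ c : K, algebraMap K F c = x) (hneg : ∀ x, σ x = -x → x = 0) (s : F) :
    (Finset.univ.filter fun τ : F × F × Kˣ × F =>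
      algebraMap K F τ.2.2.1 * (τ.2.1 * τ.2.1) - τ.2.2.2 * τ.2.2.2 + 4 * (s * τ.1) = 0 ∧
      algebraMap K F τ.2.2.1 * (τ.2.1 * σ τ.2.1) - τ.2.2.2 * σ τ.2.2.2 +
        2 * (s * σ τ.1 + τ.1 * σ s) = 0).card =
      Fintype.card F * (Fintype.card Kˣ * if s = 0 then Fintype.card F else Fintype.card K) := by
  split_ifs with hs
  · subst hs
    rw [Finset.card_filter, Fintype.sum_prod_type]
    simp only [Fintype.sum_prod_type (γ := ℕ), zero_mul, mul_zero, map_zero, add_zero]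
    have h := fun z => card_sq_eq_mul_sq hfix hneg z
    simp only [Finset.card_filter, Fintype.sum_prod_type] at h
    simp only [h, Finset.sum_const, Finset.card_univ, smul_eq_mul]
    ring
  · have h4 : 2 * 2 * s ≠ 0 := mul_ne_zero (mul_ne_zero h2 h2) hs
    have h4' : 2 * s * σ s ≠ 0 := mul_ne_zero (mul_ne_zero h2 hs) ((_root_.map_ne_zero σ).2 hs)
    have h : (Finset.univ.filter fun τ : F × Kˣ × F =>
        (σ τ.2.2 - τ.2.2) ^ 2 = algebraMap K F τ.2.1 * (σ τ.1 - τ.1) ^ 2).card =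
        Fintype.card F * (Fintype.card Kˣ * Fintype.card K) := by
      rw [Finset.card_filter, Fintype.sum_prod_type]
      have h := fun b => card_sub_sq_eq_mul_sub_sq hfix hneg b
      simp only [Finset.card_filter] at h
      simp only [h, Finset.sum_const, Finset.card_univ, smul_eq_mul]
    rw [← h]
    symm
    refine Finset.card_nbij
      (fun τ => ((τ.2.2 ^ 2 - algebraMap K F τ.2.1 * τ.1 ^ 2) * s, 2 * τ.1 * s, τ.2.1,
        2 * τ.2.2 * s)) ?_ ?_ ?_
    · rintro ⟨b, y, a⟩ h
      have h1 := (Finset.mem_filter.1 h).2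
      dsimp only at h1
      simp only [Finset.mem_coe, Finset.mem_filter, Finset.mem_univ, true_and, map_mul, map_sub,
        map_pow, AlgEquiv.commutes, map_ofNat]
      constructor
      · ring
      · linear_combination 2 * s * σ s * h1
    · rintro ⟨b, y, a⟩ - ⟨b', y', a'⟩ - h
      simp only [Prod.mk.injEq] at h
      obtain ⟨-, hb, rfl, ha⟩ := h
      rw [mul_left_cancel₀ h2 (mul_right_cancel₀ hs ha),
        mul_left_cancel₀ h2 (mul_right_cancel₀ hs hb)]
    · rintro ⟨t, z, y, x⟩ h
      obtain ⟨hα, hβ⟩ := (Finset.mem_filter.1 (Finset.mem_coe.1 h)).2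
      dsimp only at hα hβ
      obtain ⟨a, rfl⟩ : ∃ a, x = 2 * a * s := ⟨x / (2 * s), by field_simp⟩
      obtain ⟨b, rfl⟩ : ∃ b, z = 2 * b * s := ⟨z / (2 * s), by field_simp⟩
      have ht : t = (a ^ 2 - algebraMap K F y * b ^ 2) * s := by
        apply mul_left_cancel₀ h4
        linear_combination hα
      subst ht
      refine ⟨(b, y, a), ?_, rfl⟩
      simp only [Finset.coe_filter, Finset.mem_univ, true_and, Set.mem_ofPred_eq]
      apply mul_left_cancel₀ h4'
      simp only [map_mul, map_sub, map_pow, AlgEquiv.commutes, map_ofNat] at hβ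
      linear_combination hβ

end Counting

/-! ### Power moments of the exponential sums -/

section Moments

variable {K F : Type*} [Field K] [Fintype K] [DecidableEq K] [Field F] [Fintype F] [DecidableEq F]
  [Algebra K F]

theorem card_units_add_one (K : Type*) [Field K] [Fintype K] [DecidableEq K] :
    Fintype.card Kˣ + 1 = Fintype.card K := by
  rw [Fintype.card_units, Nat.sub_add_cancel Fintype.card_pos]

/-- The exponential sum of the form `y • twistedForm σ u v w`. -/
noncomputable def formSum (χ : AddChar K ℂ) (σ : F ≃ₐ[K] F) (u v w : F) (y : Kˣ) : ℂ :=
  ∑ x : F, χ (y * twistedForm σ u v w x)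

/-- The sum of `formSum` over all multipliers, see `sum_formSum`. -/
noncomputable def totalSum (σ : F ≃ₐ[K] F) (u v w : F) : ℤ :=
  (Fintype.card K : ℤ) * (Finset.univ.filter fun x => twistedForm σ u v w x = 0).card -
    Fintype.card F

omit [DecidableEq F] in
-- The sum of `χ(ya)` over `y ∈ Kˣ` is `|K| - 1` for `a = 0` and `-1` otherwise, so the total only
-- sees the number of zeros of the form.
theorem sum_formSum {χ : AddChar K ℂ} (hχ : χ.IsPrimitive) (σ : F ≃ₐ[K] F) (u v w : F) :
    ∑ y : Kˣ, formSum χ σ u v w y = totalSum σ u v w := by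
  have h : ∀ a : K, ∑ y : Kˣ, χ (y * a) = (if a = 0 then (Fintype.card K : ℂ) else 0) - 1 := by
    intro a
    have h1 := AddChar.sum_mulShift a hχ
    have h2 : ∑ x : K, χ (x * a) = χ (0 * a) + ∑ y : Kˣ, χ (y * a) := by
      rw [← Finset.add_sum_erase _ _ (Finset.mem_univ (0 : K))]
      congr 1
      refine (Finset.sum_nbij (fun y : Kˣ => (y : K)) ?_ ?_ ?_ ?_).symm
      · intro y _
        simp
      · exact fun a _ b _ h => Units.ext h
      · intro x hx
        have hx0 : x ≠ 0 := by simpa using hx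
        exact ⟨Units.mk0 x hx0, by simp, rfl⟩
      · exact fun _ _ => rfl
    rw [h2, zero_mul, AddChar.map_zero_eq_one] at h1
    rw [eq_sub_iff_add_eq, add_comm, h1]
    push_cast
    rfl
  unfold formSum totalSum
  rw [Finset.sum_comm]
  simp only [h, Finset.sum_sub_distrib, Finset.sum_ite, Finset.sum_const]
  simp [mul_comm]

section Separable
variable [FiniteDimensional K F] [Algebra.IsSeparable K F]

/-- The additive character `χ ∘ Tr`. -/
noncomputable def traceChar (F : Type*) [Field F] [Algebra K F] (χ : AddChar K ℂ) : AddChar F ℂ :=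
  χ.compAddMonoidHom (Algebra.trace K F).toAddMonoidHom

omit [DecidableEq K] [DecidableEq F] [Fintype K] [Fintype F] [FiniteDimensional K F]
  [Algebra.IsSeparable K F] in
theorem traceChar_apply (χ : AddChar K ℂ) (x : F) : traceChar F χ x = χ (Algebra.trace K F x) := rfl

omit [DecidableEq K] [DecidableEq F] [Fintype K] [Fintype F] in
theorem traceChar_isPrimitive {χ : AddChar K ℂ} (hχ : χ.IsPrimitive) :
    (traceChar F χ).IsPrimitive := by
  apply AddChar.IsPrimitive.of_ne_one
  have h1 := hχ one_ne_zero
  rw [AddChar.mulShift_one] at h1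
  obtain ⟨a, ha⟩ := AddChar.ne_one_iff.1 h1
  obtain ⟨x, rfl⟩ := Algebra.trace_surjective K F a
  exact AddChar.ne_one_iff.2 ⟨x, ha⟩

omit [DecidableEq K] [Fintype K] in
-- Orthogonality in `u` and `v` keeps only the `τ` with `α τ = β τ = 0`. There `γ τ = 0` as well,
-- which makes the result independent of `w`.
theorem sum_sum_sum_traceChar {χ : AddChar K ℂ} (hχ : χ.IsPrimitive) {T : Type*} [Fintype T]
    (α β γ : T → F) (w : F) (h : ∀ τ, α τ = 0 → β τ = 0 → γ τ = 0) :
    ∑ u, ∑ v, ∑ τ, traceChar F χ (u * α τ + v * β τ + w * γ τ) =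
      (Fintype.card F : ℂ) ^ 2 * (Finset.univ.filter fun τ => α τ = 0 ∧ β τ = 0).card := by
  have hψ := traceChar_isPrimitive (F := F) hχ
  have h1 : ∀ τ, ∑ u, ∑ v, traceChar F χ (u * α τ + v * β τ + w * γ τ) =
      if α τ = 0 ∧ β τ = 0 then (Fintype.card F : ℂ) ^ 2 else 0 := by
    intro τ
    simp only [AddChar.map_add_eq_mul, ← Finset.sum_mul, ← Finset.mul_sum]
    rw [AddChar.sum_mulShift _ hψ, AddChar.sum_mulShift _ hψ]
    by_cases ha : α τ = 0
    · by_cases hb : β τ = 0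
      · simp [ha, hb, h τ ha hb, sq]
      · simp [hb]
    · simp [ha]
  calc _ = ∑ τ, ∑ u, ∑ v, traceChar F χ (u * α τ + v * β τ + w * γ τ) := by
        rw [Finset.sum_comm]
        rw [Finset.sum_congr rfl fun v _ => Finset.sum_comm]
        rw [Finset.sum_comm]
        exact Finset.sum_congr rfl fun τ _ => Finset.sum_comm
    _ = _ := by
        simp only [h1]
        rw [Finset.sum_ite, Finset.sum_const, Finset.sum_const_zero, add_zero, nsmul_eq_mul,
          mul_comm]

omit [DecidableEq K] [DecidableEq F] [Fintype K] [FiniteDimensional K F]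
  [Algebra.IsSeparable K F] in
theorem formSum_eq (χ : AddChar K ℂ) (σ : F ≃ₐ[K] F) (u v w : F) (y : Kˣ) :
    formSum χ σ u v w y = ∑ z, traceChar F χ (u * (algebraMap K F y * (z * z)) +
      v * (algebraMap K F y * (z * σ z)) + w * (algebraMap K F y * (z * σ (σ z)))) := by
  refine Finset.sum_congr rfl fun z _ => ?_
  rw [traceChar_apply, twistedForm_apply, ← smul_eq_mul, ← map_smul, Algebra.smul_def]
  congr 2
  ring

omit [DecidableEq K] [DecidableEq F] [Fintype K] [FiniteDimensional K F]
  [Algebra.IsSeparable K F] in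
theorem formSum_neg_one (χ : AddChar K ℂ) (σ : F ≃ₐ[K] F) (u v w : F) :
    formSum χ σ u v w (-1) = ∑ z, traceChar F χ (u * (-(z * z)) +
      v * (-(z * σ z)) + w * (-(z * σ (σ z)))) := by
  rw [formSum_eq]
  simp

omit [DecidableEq K] [DecidableEq F] [Fintype K] [FiniteDimensional K F]
  [Algebra.IsSeparable K F] in
-- The substitution `x = s + t`, `x' = s - t` turns `Q(x) - Q(x')` into twice the polar form of `s`
-- and `t`. The resulting equations are linear in `t`, which makes the higher moments countable.
theorem formSum_one_mul_neg_one (h2 : (2 : F) ≠ 0) (χ : AddChar K ℂ) (σ : F ≃ₐ[K] F) (u v w : F) :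
    formSum χ σ u v w 1 * formSum χ σ u v w (-1) = ∑ s, ∑ t, traceChar F χ (u * (4 * (s * t)) +
      v * (2 * (s * σ t + t * σ s)) + w * (2 * (s * σ (σ t) + t * σ (σ s)))) := by
  let e : F × F ≃ F × F :=
    { toFun := fun a => (a.1 + a.2, a.1 - a.2)
      invFun := fun a => ((a.1 + a.2) / 2, (a.1 - a.2) / 2)
      left_inv := fun a => by ext <;> (simp only; field_simp; ring)
      right_inv := fun a => by ext <;> (simp only; field_simp; ring) }
  rw [formSum_neg_one, formSum_eq, Finset.sum_mul_sum, ← Fintype.sum_prod_type',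
    ← Fintype.sum_prod_type', ← Equiv.sum_comp e]
  refine Finset.sum_congr rfl fun a _ => ?_
  rw [← AddChar.map_add_eq_mul]
  congr 1
  simp only [e, Equiv.coe_fn_mk, map_add, map_sub, Units.val_one, map_one]
  ring

theorem sum_ite_eq_zero (a b : ℕ) :
    ∑ s : F, (if s = 0 then a else b) = a + (Fintype.card F - 1) * b := by
  rw [← Finset.add_sum_erase _ _ (Finset.mem_univ (0 : F)), if_pos rfl,
    Finset.sum_congr rfl (g := fun _ => b) fun s hs => if_neg (Finset.ne_of_mem_erase hs),
    Finset.sum_const, Finset.card_erase_of_mem (Finset.mem_univ _), Finset.card_univ, smul_eq_mul]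

variable {χ : AddChar K ℂ} {σ : F ≃ₐ[K] F}

theorem sum_sum_formSum (hχ : χ.IsPrimitive) (w : F) :
    ∑ u, ∑ v, ∑ y, formSum χ σ u v w y = (Fintype.card F : ℂ) ^ 2 * Fintype.card Kˣ := by
  have h := sum_sum_sum_traceChar hχ (T := Kˣ × F)
    (fun τ => algebraMap K F τ.1 * (τ.2 * τ.2)) (fun τ => algebraMap K F τ.1 * (τ.2 * σ τ.2))
    (fun τ => algebraMap K F τ.1 * (τ.2 * σ (σ τ.2))) w
    (fun τ h1 _ => by
      have : τ.2 = 0 := by simpa using h1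
      simp [this])
  simp only [Fintype.sum_prod_type, ← formSum_eq] at h
  rw [h, ← Finset.card_univ (α := Kˣ), ← Finset.card_image_of_injective
    (f := fun y : Kˣ => (y, (0 : F))) Finset.univ (fun a b h => (Prod.ext_iff.1 h).1)]
  congr 3
  ext ⟨y, x⟩
  have hy : algebraMap K F y ≠ 0 := (_root_.map_ne_zero _).2 y.ne_zero
  simp only [Finset.mem_filter, Finset.mem_univ, true_and, Finset.mem_image, Prod.mk.injEq]
  constructor
  · rintro ⟨h, -⟩
    exact ⟨y, rfl, by simpa [hy, eq_comm] using h⟩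
  · rintro ⟨y, rfl, rfl⟩
    simp

variable (hfix : ∀ x, σ x = x → ∃ c : K, algebraMap K F c = x) (hneg : ∀ x, σ x = -x → x = 0)
  (h2 : (2 : F) ≠ 0)
include hfix hneg h2

/-- One factor stays summed over all multipliers: this removes the odd ranks, whose individual sums
need not vanish, and makes the count uniform in `z`. The other factor has multiplier `-1`. -/
theorem sum_sum_formSum_mul (hχ : χ.IsPrimitive) (w : F) :
    ∑ u, ∑ v, (∑ y, formSum χ σ u v w y) * formSum χ σ u v w (-1) =
      (Fintype.card F : ℂ) ^ 2 * (Fintype.card F * Fintype.card Kˣ) := by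
  have h := sum_sum_sum_traceChar hχ (T := F × Kˣ × F)
    (fun τ => algebraMap K F τ.2.1 * (τ.1 * τ.1) - τ.2.2 * τ.2.2)
    (fun τ => algebraMap K F τ.2.1 * (τ.1 * σ τ.1) - τ.2.2 * σ τ.2.2)
    (fun τ => algebraMap K F τ.2.1 * (τ.1 * σ (σ τ.1)) - τ.2.2 * σ (σ τ.2.2)) w
    (fun τ h1 h3 => by
      simpa using twisted_relation h2 hfix hneg (s := 0) (t := 0) (y := τ.2.1) (z := τ.1)
        (x := τ.2.2) (by simpa using h1) (by simpa using h3))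
  have h1 : (Finset.univ.filter fun τ : F × Kˣ × F =>
      algebraMap K F τ.2.1 * (τ.1 * τ.1) - τ.2.2 * τ.2.2 = 0 ∧
      algebraMap K F τ.2.1 * (τ.1 * σ τ.1) - τ.2.2 * σ τ.2.2 = 0).card =
      Fintype.card F * Fintype.card Kˣ := by
    have := fun z => card_sq_eq_mul_sq hfix hneg z
    simp only [Finset.card_filter] at this ⊢
    rw [Fintype.sum_prod_type]
    simp [this]
  rw [h1] at h
  push_cast at h
  rw [← h]
  refine Finset.sum_congr rfl fun u _ => Finset.sum_congr rfl fun v _ => ?_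
  have h3 : ∀ (z : F) (y : Kˣ) (x : F), traceChar F χ
      (u * (algebraMap K F y * (z * z) - x * x) + v * (algebraMap K F y * (z * σ z) - x * σ x) +
        w * (algebraMap K F y * (z * σ (σ z)) - x * σ (σ x))) =
      traceChar F χ (u * (algebraMap K F y * (z * z)) +
        v * (algebraMap K F y * (z * σ z)) + w * (algebraMap K F y * (z * σ (σ z)))) *
      traceChar F χ (u * (-(x * x)) + v * (-(x * σ x)) + w * (-(x * σ (σ x)))) := by
    intro z y x
    rw [← AddChar.map_add_eq_mul]
    congr 1
    ring
  rw [formSum_neg_one]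
  simp only [formSum_eq]
  rw [Finset.sum_comm]
  simp only [Fintype.sum_prod_type, h3, ← Finset.mul_sum, ← Finset.sum_mul]

theorem sum_sum_formSum_mul_mul (hχ : χ.IsPrimitive) (w : F) :
    ∑ u, ∑ v, (∑ y, formSum χ σ u v w y) * (formSum χ σ u v w 1 * formSum χ σ u v w (-1)) =
      (Fintype.card F : ℂ) ^ 2 *
        (Fintype.card Kˣ * (Fintype.card F + (Fintype.card F - 1) * Fintype.card K)) := by
  have h := sum_sum_sum_traceChar hχ (T := (Kˣ × F) × (F × F))
    (fun τ => algebraMap K F τ.1.1 * (τ.2.1 * τ.2.1) + 4 * (τ.1.2 * τ.2.2))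
    (fun τ => algebraMap K F τ.1.1 * (τ.2.1 * σ τ.2.1) + 2 * (τ.1.2 * σ τ.2.2 + τ.2.2 * σ τ.1.2))
    (fun τ => algebraMap K F τ.1.1 * (τ.2.1 * σ (σ τ.2.1)) +
      2 * (τ.1.2 * σ (σ τ.2.2) + τ.2.2 * σ (σ τ.1.2))) w
    (fun τ h1 h3 => by
      simpa using twisted_relation h2 hfix hneg (s := τ.1.2) (t := τ.2.2) (y := τ.1.1) (z := τ.2.1)
        (x := 0) (by simpa using h1) (by simpa using h3))
  have h1 : (Finset.univ.filter fun τ : (Kˣ × F) × (F × F) =>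
      algebraMap K F τ.1.1 * (τ.2.1 * τ.2.1) + 4 * (τ.1.2 * τ.2.2) = 0 ∧
      algebraMap K F τ.1.1 * (τ.2.1 * σ τ.2.1) + 2 * (τ.1.2 * σ τ.2.2 + τ.2.2 * σ τ.1.2) =
        0).card =
      Fintype.card Kˣ * (Fintype.card F + (Fintype.card F - 1) * Fintype.card K) := by
    have := fun y s => card_triple_relation h2 hfix y s
    simp only [Finset.card_filter] at this ⊢
    rw [Fintype.sum_prod_type]
    simp only [this]
    rw [Fintype.sum_prod_type]
    simp only [sum_ite_eq_zero, Finset.sum_const, Finset.card_univ, smul_eq_mul]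
  rw [h1] at h
  push_cast [Nat.cast_sub (Fintype.card_pos (α := F) : 1 ≤ Fintype.card F)] at h
  rw [← h]
  refine Finset.sum_congr rfl fun u _ => Finset.sum_congr rfl fun v _ => ?_
  have h3 : ∀ (z : F) (y : Kˣ) (s t : F), traceChar F χ
      (u * (algebraMap K F y * (z * z) + 4 * (s * t)) +
        v * (algebraMap K F y * (z * σ z) + 2 * (s * σ t + t * σ s)) +
        w * (algebraMap K F y * (z * σ (σ z)) + 2 * (s * σ (σ t) + t * σ (σ s)))) =
      traceChar F χ (u * (algebraMap K F y * (z * z)) +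
        v * (algebraMap K F y * (z * σ z)) + w * (algebraMap K F y * (z * σ (σ z)))) *
      traceChar F χ (u * (4 * (s * t)) + v * (2 * (s * σ t + t * σ s)) +
        w * (2 * (s * σ (σ t) + t * σ (σ s)))) := by
    intro z y s t
    rw [← AddChar.map_add_eq_mul]
    congr 1
    ring
  rw [formSum_one_mul_neg_one h2]
  simp only [formSum_eq]
  simp only [Fintype.sum_prod_type, h3, ← Finset.mul_sum, ← Finset.sum_mul]

theorem sum_sum_formSum_mul_mul_mul (hχ : χ.IsPrimitive) (w : F) :
    ∑ u, ∑ v, (∑ y, formSum χ σ u v w y) * formSum χ σ u v w (-1) *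
        (formSum χ σ u v w 1 * formSum χ σ u v w (-1)) =
      (Fintype.card F : ℂ) ^ 2 * (Fintype.card F *
        (Fintype.card Kˣ * (Fintype.card F + (Fintype.card F - 1) * Fintype.card K))) := by
  have h := sum_sum_sum_traceChar hχ (T := F × F × F × Kˣ × F)
    (fun τ => algebraMap K F τ.2.2.2.1 * (τ.2.2.1 * τ.2.2.1) - τ.2.2.2.2 * τ.2.2.2.2 +
      4 * (τ.1 * τ.2.1))
    (fun τ => algebraMap K F τ.2.2.2.1 * (τ.2.2.1 * σ τ.2.2.1) - τ.2.2.2.2 * σ τ.2.2.2.2 +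
      2 * (τ.1 * σ τ.2.1 + τ.2.1 * σ τ.1))
    (fun τ => algebraMap K F τ.2.2.2.1 * (τ.2.2.1 * σ (σ τ.2.2.1)) - τ.2.2.2.2 * σ (σ τ.2.2.2.2) +
      2 * (τ.1 * σ (σ τ.2.1) + τ.2.1 * σ (σ τ.1))) w
    (fun τ h1 h3 => twisted_relation h2 hfix hneg h1 h3)
  have h1 : (Finset.univ.filter fun τ : F × F × F × Kˣ × F =>
      algebraMap K F τ.2.2.2.1 * (τ.2.2.1 * τ.2.2.1) - τ.2.2.2.2 * τ.2.2.2.2 +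
        4 * (τ.1 * τ.2.1) = 0 ∧
      algebraMap K F τ.2.2.2.1 * (τ.2.2.1 * σ τ.2.2.1) - τ.2.2.2.2 * σ τ.2.2.2.2 +
        2 * (τ.1 * σ τ.2.1 + τ.2.1 * σ τ.1) = 0).card =
      Fintype.card F *
        (Fintype.card Kˣ * (Fintype.card F + (Fintype.card F - 1) * Fintype.card K)) := by
    have := fun s => card_quadruple_relation h2 hfix hneg s
    simp only [Finset.card_filter] at this ⊢
    rw [Fintype.sum_prod_type]
    simp only [this, ← Finset.mul_sum, sum_ite_eq_zero]
  rw [h1] at h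
  push_cast [Nat.cast_sub (Fintype.card_pos (α := F) : 1 ≤ Fintype.card F)] at h
  rw [← h]
  refine Finset.sum_congr rfl fun u _ => Finset.sum_congr rfl fun v _ => ?_
  have h3 : ∀ (z : F) (y : Kˣ) (x s t : F), traceChar F χ
      (u * (algebraMap K F y * (z * z) - x * x + 4 * (s * t)) +
        v * (algebraMap K F y * (z * σ z) - x * σ x + 2 * (s * σ t + t * σ s)) +
        w * (algebraMap K F y * (z * σ (σ z)) - x * σ (σ x) +
          2 * (s * σ (σ t) + t * σ (σ s)))) =
      traceChar F χ (u * (algebraMap K F y * (z * z)) +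
        v * (algebraMap K F y * (z * σ z)) + w * (algebraMap K F y * (z * σ (σ z)))) *
      traceChar F χ (u * (-(x * x)) + v * (-(x * σ x)) + w * (-(x * σ (σ x)))) *
      traceChar F χ (u * (4 * (s * t)) + v * (2 * (s * σ t + t * σ s)) +
        w * (2 * (s * σ (σ t) + t * σ (σ s)))) := by
    intro z y x s t
    rw [← AddChar.map_add_eq_mul, ← AddChar.map_add_eq_mul]
    congr 1
    ring
  rw [formSum_one_mul_neg_one h2, formSum_neg_one]
  simp only [formSum_eq]
  rw [Finset.sum_comm]
  simp only [Fintype.sum_prod_type, h3, ← Finset.mul_sum, ← Finset.sum_mul]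

/-- The first four power moments of the normalized exponential sums. -/
theorem sum_pow_eq (hχ : χ.IsPrimitive) (w : F) (e : F × F → ℤ)
    (he : ∀ a, totalSum σ a.1 a.2 w = (Fintype.card K - 1) * e a)
    (he' : ∀ a, e a = 0 ∨ ∀ y, formSum χ σ a.1 a.2 w y = e a) :
    ∑ a, e a = (Fintype.card F : ℤ) ^ 2 ∧ ∑ a, e a ^ 2 = (Fintype.card F : ℤ) ^ 3 ∧
    ∑ a, e a ^ 3 = (Fintype.card F : ℤ) ^ 2 *
      (Fintype.card F + (Fintype.card F - 1) * Fintype.card K) ∧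
    ∑ a, e a ^ 4 = (Fintype.card F : ℤ) ^ 3 *
      (Fintype.card F + (Fintype.card F - 1) * Fintype.card K) := by
  have hcard : (Fintype.card Kˣ : ℂ) = Fintype.card K - 1 := by
    rw [← card_units_add_one K]; push_cast; ring
  have hne : (Fintype.card K : ℂ) - 1 ≠ 0 := by
    rw [← hcard]
    exact_mod_cast Fintype.card_ne_zero
  have htot : ∀ u v, ∑ y, formSum χ σ u v w y = (Fintype.card K - 1) * (e (u, v) : ℂ) := by
    intro u v
    rw [sum_formSum hχ, he (u, v)]
    push_cast
    rfl
  have m1 := sum_sum_formSum (σ := σ) hχ w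
  have m2 := sum_sum_formSum_mul hfix hneg h2 hχ w
  have m3 := sum_sum_formSum_mul_mul hfix hneg h2 hχ w
  have m4 := sum_sum_formSum_mul_mul_mul hfix hneg h2 hχ w
  -- If `e = 0`, the total factor vanishes and the other factors are irrelevant; otherwise each of
  -- them equals `e`, whatever its multiplier. The same holds for `e3` and `e4`.
  have e2 : ∀ u v, (∑ y, formSum χ σ u v w y) * formSum χ σ u v w (-1) =
      (Fintype.card K - 1) * (e (u, v) : ℂ) ^ 2 := by
    intro u v
    rw [htot]
    rcases he' (u, v) with h | h
    · simp [h]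
    · rw [h]; ring
  have e3 : ∀ u v, (∑ y, formSum χ σ u v w y) *
      (formSum χ σ u v w 1 * formSum χ σ u v w (-1)) =
      (Fintype.card K - 1) * (e (u, v) : ℂ) ^ 3 := by
    intro u v
    rw [htot]
    rcases he' (u, v) with h | h
    · simp [h]
    · rw [h, h]; ring
  have e4 : ∀ u v, (∑ y, formSum χ σ u v w y) * formSum χ σ u v w (-1) *
      (formSum χ σ u v w 1 * formSum χ σ u v w (-1)) =
      (Fintype.card K - 1) * (e (u, v) : ℂ) ^ 4 := by
    intro u v
    rw [htot]
    rcases he' (u, v) with h | h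
    · simp [h]
    · rw [h, h]; ring
  simp only [e4] at m4
  simp only [e3] at m3
  simp only [e2] at m2
  simp only [htot] at m1
  simp only [← Finset.mul_sum, hcard] at m1 m2 m3 m4
  simp only [← Fintype.sum_prod_type' (f := fun u v => ((e (u, v) : ℂ)) ^ _)] at m2 m3 m4
  simp only [← Fintype.sum_prod_type' (f := fun u v => ((e (u, v) : ℂ)))] at m1
  refine ⟨?_, ?_, ?_, ?_⟩ <;> apply Int.cast_injective (α := ℂ) <;> push_cast <;>
    apply mul_left_cancel₀ hne
  · rw [m1]; ring
  · rw [m2]; ring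
  · rw [m3]; ring
  · rw [m4]; ring

end Separable

end Moments

/-! ### Value distribution from the moments -/

section Distribution

theorem Finset.sum_comp_eq_sum_card {T : Type*} [Fintype T] (e : T → ℤ) (V : Finset ℤ)
    (hV : ∀ a, e a ∈ V) (f : ℤ → ℚ) :
    ∑ a, f (e a) = ∑ z ∈ V, ((Finset.univ.filter fun a => e a = z).card : ℚ) * f z := by
  rw [← Finset.sum_fiberwise_of_maps_to (t := V) (g := e) fun a _ => hV a]
  refine Finset.sum_congr rfl fun z _ => ?_
  rw [Finset.sum_congr rfl (g := fun _ => f z) fun a ha => by rw [(Finset.mem_filter.1 ha).2],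
    Finset.sum_const, nsmul_eq_mul]

variable {K F : Type*} [Field K] [Fintype K] [DecidableEq K] [Field F] [Fintype F] [DecidableEq F]
  [Algebra K F] [FiniteDimensional K F] [Algebra.IsSeparable K F]

/-- The number of pairs `(u, v)` with a given value of `totalSum σ u v w`. -/
noncomputable def totalSumCount (σ : F ≃ₐ[K] F) (w : F) (z : ℤ) : ℕ :=
  (Finset.univ.filter fun a : F × F => totalSum σ a.1 a.2 w = z).card

omit [DecidableEq F] [FiniteDimensional K F] [Algebra.IsSeparable K F] in
theorem totalSum_zero (σ : F ≃ₐ[K] F) :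
    totalSum σ 0 0 0 = ((Fintype.card K : ℤ) - 1) * Fintype.card F := by
  simp [totalSum, twistedForm_apply]
  ring

variable (hK : ringChar K ≠ 2) {χ : AddChar K ℂ} (hχ : χ.IsPrimitive) {σ : F ≃ₐ[K] F}
  (hfix : ∀ x, σ x = x → ∃ c : K, algebraMap K F c = x)
include hK hχ hfix

/-- The dimension `2n + 3` is odd, so even rank means odd corank. The bound on the radical leaves
corank 1, giving `±|K|^(n+2)`, and for `w ≠ 0` also corank 3, giving `±|K|^(n+3)`. Odd rank gives `e
= 0`. -/
theorem exists_normalized_totalSum {n : ℕ} (hn : Module.finrank K F = 2 * n + 3) {u v w : F}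
    (h : ¬(u = 0 ∧ v = 0 ∧ w = 0)) :
    ∃ e : ℤ, totalSum σ u v w = (Fintype.card K - 1) * e ∧
      (e = 0 ∨ ∀ y, formSum χ σ u v w y = e) ∧
      (e = 0 ∨ (e = Fintype.card K ^ (n + 2) ∨ e = -Fintype.card K ^ (n + 2)) ∨
        (w ≠ 0 ∧ (e = Fintype.card K ^ (n + 3) ∨ e = -Fintype.card K ^ (n + 3)))) := by
  have hq : 1 < Fintype.card K := Fintype.one_lt_card
  obtain ⟨r, hr, hrad, hodd, heven⟩ := (twistedForm σ u v w).exists_rank_expSum hK hχ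
  have h1 := (pow_le_pow_iff_right₀ hq).1
    (hrad.trans (card_twistedForm_radical_le hK σ hfix h))
  rw [hn] at h1 hr heven
  have htot := sum_formSum hχ σ u v w
  rcases Nat.even_or_odd r with he | ho
  · obtain ⟨ε, hε, hG⟩ := heven he
    have hG' : ∀ y, formSum χ σ u v w y = ε * (Fintype.card K : ℂ) ^ (2 * n + 3 - r / 2) := hG
    refine ⟨ε * Fintype.card K ^ (2 * n + 3 - r / 2), ?_, Or.inr fun y => ?_, Or.inr ?_⟩
    · simp only [hG', Finset.sum_const, Finset.card_univ, nsmul_eq_mul] at htot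
      have hc : (Fintype.card Kˣ : ℂ) = Fintype.card K - 1 := by
        rw [← card_units_add_one K]; push_cast; ring
      rw [hc] at htot
      apply Int.cast_injective (α := ℂ)
      rw [← htot]
      push_cast
      ring
    · rw [hG']
      push_cast
      rfl
    · obtain ⟨s, rfl⟩ := he
      have h2 : 2 * n + 3 - (s + s) / 2 = n + 2 ∨
          (w ≠ 0 ∧ 2 * n + 3 - (s + s) / 2 = n + 3) := by
        split_ifs at h1 with hw
        · left; omega
        · by_cases h3 : s = n + 1
          · left; omega
          · right; exact ⟨hw, by omega⟩
      rcases h2 with h2 | ⟨hw, h2⟩ <;> rw [h2] <;> rcases hε with rfl | rfl <;> simp [*]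
  · refine ⟨0, ?_, Or.inl rfl, Or.inl rfl⟩
    have : ∑ y, formSum χ σ u v w y = 0 := hodd ho
    rw [this] at htot
    rw [mul_zero]
    exact_mod_cast htot.symm

variable (hneg : ∀ x, σ x = -x → x = 0)
include hneg

omit [DecidableEq F] in
-- The value `|K|^(2n+3)` is attained by the zero form alone. The three other counts are determined
-- by the number of pairs and the first two moments.
theorem totalSumCount_zero {n : ℕ} (hn : Module.finrank K F = 2 * n + 3) (P : ℚ)
    (hP : P = Fintype.card K) :
    (totalSumCount σ (0 : F) 0 : ℚ) = (P ^ (2 * n + 3) - 1) * (P ^ (2 * n + 3) - P ^ (2 * n + 2) + 1) ∧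
    ∀ ε : ℤ, (ε = 1 ∨ ε = -1) →
      (totalSumCount σ (0 : F) (ε * ((Fintype.card K - 1) * Fintype.card K ^ (n + 2))) : ℚ) =
        1 / 2 * (P ^ (2 * n + 3) - 1) * (P ^ (2 * n + 2) + ε * P ^ (n + 1)) := by
  classical
  have hq : 1 < Fintype.card K := Fintype.one_lt_card
  have hF : Fintype.card F = Fintype.card K ^ (2 * n + 3) := by
    rw [← hn]; exact Module.card_eq_pow_finrank
  have h2 : (2 : F) ≠ 0 := by
    have : (2 : K) ≠ 0 := Ring.two_ne_zero hK
    rw [← map_ofNat (algebraMap K F) 2]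
    exact (_root_.map_ne_zero _).2 this
  have hex : ∀ a : F × F, ∃ e : ℤ, totalSum σ a.1 a.2 0 = (Fintype.card K - 1) * e ∧
      (e = 0 ∨ ∀ y, formSum χ σ a.1 a.2 0 y = e) ∧
      ((a = 0 ∧ e = Fintype.card K ^ (2 * n + 3)) ∨ (a ≠ 0 ∧
      (e = 0 ∨ e = Fintype.card K ^ (n + 2) ∨ e = -Fintype.card K ^ (n + 2)))) := by
    rintro ⟨u, v⟩
    by_cases h : u = 0 ∧ v = 0
    · obtain ⟨rfl, rfl⟩ := h
      refine ⟨Fintype.card F, totalSum_zero σ, Or.inr fun y => ?_, Or.inl ⟨rfl, ?_⟩⟩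
      · simp [formSum, twistedForm_apply]
      · rw [hF]; push_cast; rfl
    · obtain ⟨e, h1, h2, h3⟩ := exists_normalized_totalSum hK hχ hfix hn (u := u) (v := v) (w := 0)
        (fun h' => h ⟨h'.1, h'.2.1⟩)
      refine ⟨e, h1, h2, Or.inr ⟨fun h' => h (by simpa using h'), ?_⟩⟩
      rcases h3 with h3 | h3 | h3
      · exact Or.inl h3
      · exact Or.inr h3
      · exact absurd rfl h3.1
  choose e he1 he2 he3 using hex
  obtain ⟨m1, m2, -, -⟩ := sum_pow_eq hfix hneg h2 hχ 0 e he1 he2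
  set q : ℤ := (Fintype.card K : ℤ) with hqdef
  have hq1 : (1 : ℤ) < q := by rw [hqdef]; exact_mod_cast hq
  set B : ℤ := q ^ (n + 2) with hB
  have hB0 : 0 < B := by positivity
  have hQB : q ^ (2 * n + 3) = B * q ^ (n + 1) := by rw [hB]; ring
  have hQ : B < q ^ (2 * n + 3) := pow_lt_pow_right₀ hq1 (by omega)
  set V : Finset ℤ := {q ^ (2 * n + 3), 0, B, -B} with hV
  have hmem : ∀ a, e a ∈ V := by
    intro a
    simp only [hV, Finset.mem_insert, Finset.mem_singleton]
    rcases he3 a with h | h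
    · exact Or.inl h.2
    · exact Or.inr h.2
  set N : ℤ → ℚ := fun z => ((Finset.univ.filter fun a => e a = z).card : ℚ) with hN
  have hcount : ∀ z : ℤ, (totalSumCount σ (0 : F) ((q - 1) * z) : ℚ) = N z := by
    intro z
    rw [hN, totalSumCount]
    congr 2
    ext a
    simp only [Finset.mem_filter, Finset.mem_univ, true_and, he1]
    rw [mul_right_inj' (by omega)]
  have hNQ : N (q ^ (2 * n + 3)) = 1 := by
    have : (Finset.univ.filter fun a => e a = q ^ (2 * n + 3)) = {0} := by
      ext a
      simp only [Finset.mem_filter, Finset.mem_univ, true_and, Finset.mem_singleton]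
      constructor
      · intro h
        rcases he3 a with h' | ⟨-, h' | h' | h'⟩
        · exact h'.1
        all_goals omega
      · rintro rfl
        rcases he3 0 with h' | h'
        · exact h'.2
        · exact absurd rfl h'.1
    simp [hN, this]
  have key : ∀ f : ℤ → ℚ, ∑ a, f (e a) =
      N (q ^ (2 * n + 3)) * f (q ^ (2 * n + 3)) + (N 0 * f 0 + (N B * f B + N (-B) * f (-B))) := by
    intro f
    rw [Finset.sum_comp_eq_sum_card e V hmem f, hV, Finset.sum_insert, Finset.sum_insert,
      Finset.sum_insert, Finset.sum_singleton]
    · simp only [Finset.mem_singleton]; omega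
    · simp only [Finset.mem_insert, Finset.mem_singleton]; omega
    · simp only [Finset.mem_insert, Finset.mem_singleton]; omega
  have k0 := key fun _ => 1
  have k1 := key fun z => z
  have k2 := key fun z => (z : ℚ) ^ 2
  have m1' := congrArg (Int.cast : ℤ → ℚ) m1
  have m2' := congrArg (Int.cast : ℤ → ℚ) m2
  push_cast at m1' m2'
  rw [m1'] at k1
  rw [m2'] at k2
  have hPq : (q : ℚ) = P := by rw [hP, hqdef]; push_cast; rfl
  have hFP : (Fintype.card F : ℚ) = P ^ 3 * (P ^ n) ^ 2 := by rw [hF, hP]; push_cast; ring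
  have hQP : ((q ^ (2 * n + 3) : ℤ) : ℚ) = P ^ 3 * (P ^ n) ^ 2 := by
    push_cast; rw [hPq]; ring
  have hBP : (B : ℚ) = P ^ 2 * P ^ n := by rw [hB]; push_cast; rw [hPq]; ring
  have hc0 : ∑ a : F × F, (1 : ℚ) = (P ^ 3 * (P ^ n) ^ 2) ^ 2 := by
    simp only [Finset.sum_const, Finset.card_univ, Fintype.card_prod, nsmul_eq_mul, mul_one]
    push_cast
    rw [hFP]
    ring
  have hP0 : P ≠ 0 := by rw [← hPq]; exact_mod_cast (by omega : q ≠ 0)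
  have e0 : P ^ (2 * n + 3) = P ^ 3 * (P ^ n) ^ 2 := by ring
  have e1 : P ^ (2 * n + 2) = P ^ 2 * (P ^ n) ^ 2 := by ring
  have e2 : P ^ (n + 1) = P * P ^ n := by ring
  have hx0 : P ^ n ≠ 0 := pow_ne_zero n hP0
  rw [e0, e1, e2]
  -- With `x` for `P^n`, all equations become polynomial identities in `P` and `x`.
  generalize P ^ n = x at *
  rw [hc0, hNQ] at k0
  rw [hNQ] at k1 k2
  push_cast at k1 k2 hQP
  rw [hQP] at k1 k2
  rw [hBP, hFP] at k1 k2
  have s1 : N B - N (-B) = P * x * (P ^ 3 * x ^ 2 - 1) := by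
    apply mul_left_cancel₀ (mul_ne_zero (pow_ne_zero 2 hP0) hx0)
    linear_combination -k1
  have s2 : N B + N (-B) = P ^ 2 * x ^ 2 * (P ^ 3 * x ^ 2 - 1) := by
    apply mul_left_cancel₀ (mul_ne_zero (pow_ne_zero 4 hP0) (pow_ne_zero 2 hx0))
    linear_combination -k2
  refine ⟨?_, ?_⟩
  · have := hcount 0
    rw [mul_zero] at this
    rw [this]
    linear_combination -k0 - s2
  · rintro ε (rfl | rfl)
    · have := hcount B
      rw [one_mul, this]
      push_cast
      linear_combination s1 / 2 + s2 / 2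
    · have := hcount (-B)
      rw [neg_one_mul, ← mul_neg, this]
      push_cast
      linear_combination -s1 / 2 + s2 / 2

omit [DecidableEq F] in
theorem totalSumCount_ne_zero {n : ℕ} (hn : Module.finrank K F = 2 * n + 3) (P : ℚ)
    (hP : P = Fintype.card K) {w : F} (hw : w ≠ 0) :
    (totalSumCount σ w 0 : ℚ) =
      P ^ (4 * n + 6) - P ^ (4 * n + 5) + P ^ (4 * n + 2) - P ^ (2 * n) ∧
    ∀ ε : ℤ, (ε = 1 ∨ ε = -1) →
      (totalSumCount σ w (ε * ((Fintype.card K - 1) * Fintype.card K ^ (n + 2))) : ℚ) =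
        (P ^ (2 * n + 5) - P ^ (2 * n + 3) - P ^ (2 * n + 2) + 1) *
          (P ^ (2 * n + 2) + ε * P ^ (n + 1)) / (2 * (P ^ 2 - 1)) ∧
      (totalSumCount σ w (ε * ((Fintype.card K - 1) * Fintype.card K ^ (n + 3))) : ℚ) =
        (P ^ (2 * n + 2) - 1) * (P ^ (2 * n) + ε * P ^ n) / (2 * (P ^ 2 - 1)) := by
  classical
  have hq : 1 < Fintype.card K := Fintype.one_lt_card
  have hF : Fintype.card F = Fintype.card K ^ (2 * n + 3) := by
    rw [← hn]; exact Module.card_eq_pow_finrank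
  have h2 : (2 : F) ≠ 0 := by
    have : (2 : K) ≠ 0 := Ring.two_ne_zero hK
    rw [← map_ofNat (algebraMap K F) 2]
    exact (_root_.map_ne_zero _).2 this
  choose e he1 he2 he3 using fun a : F × F => exists_normalized_totalSum hK hχ hfix hn
    (u := a.1) (v := a.2) (w := w) (fun h' => hw h'.2.2)
  obtain ⟨m1, m2, m3, m4⟩ := sum_pow_eq hfix hneg h2 hχ w e he1 he2
  set q : ℤ := (Fintype.card K : ℤ) with hqdef
  have hq1 : (1 : ℤ) < q := by rw [hqdef]; exact_mod_cast hq
  set B : ℤ := q ^ (n + 2) with hB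
  set C : ℤ := q ^ (n + 3) with hC
  have hB0 : 0 < B := by positivity
  have hBC : B < C := pow_lt_pow_right₀ hq1 (by omega)
  set V : Finset ℤ := {0, B, -B, C, -C} with hV
  have hmem : ∀ a, e a ∈ V := by
    intro a
    simp only [hV, Finset.mem_insert, Finset.mem_singleton]
    rcases he3 a with h | (h | h) | ⟨-, h | h⟩ <;> simp [h]
  set N : ℤ → ℚ := fun z => ((Finset.univ.filter fun a => e a = z).card : ℚ) with hN
  have hcount : ∀ z : ℤ, (totalSumCount σ w ((q - 1) * z) : ℚ) = N z := by
    intro z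
    rw [hN, totalSumCount]
    congr 2
    ext a
    simp only [Finset.mem_filter, Finset.mem_univ, true_and, he1]
    rw [mul_right_inj' (by omega)]
  have key : ∀ f : ℤ → ℚ, ∑ a, f (e a) =
      N 0 * f 0 + (N B * f B + (N (-B) * f (-B) + (N C * f C + N (-C) * f (-C)))) := by
    intro f
    rw [Finset.sum_comp_eq_sum_card e V hmem f, hV, Finset.sum_insert, Finset.sum_insert,
      Finset.sum_insert, Finset.sum_insert, Finset.sum_singleton]
    · simp only [Finset.mem_singleton]; omega
    · simp only [Finset.mem_insert, Finset.mem_singleton]; omega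
    · simp only [Finset.mem_insert, Finset.mem_singleton]; omega
    · simp only [Finset.mem_insert, Finset.mem_singleton]; omega
  have k0 := key fun _ => 1
  have k1 := key fun z => z
  have k2 := key fun z => (z : ℚ) ^ 2
  have k3 := key fun z => (z : ℚ) ^ 3
  have k4 := key fun z => (z : ℚ) ^ 4
  have m1' := congrArg (Int.cast : ℤ → ℚ) m1
  have m2' := congrArg (Int.cast : ℤ → ℚ) m2
  have m3' := congrArg (Int.cast : ℤ → ℚ) m3
  have m4' := congrArg (Int.cast : ℤ → ℚ) m4
  push_cast at m1' m2' m3' m4'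
  rw [m1'] at k1
  rw [m2'] at k2
  rw [m3'] at k3
  rw [m4'] at k4
  have hPq : (q : ℚ) = P := by rw [hP, hqdef]; push_cast; rfl
  have hFP : (Fintype.card F : ℚ) = P ^ 3 * (P ^ n) ^ 2 := by rw [hF, hP]; push_cast; ring
  have hBP : (B : ℚ) = P ^ 2 * P ^ n := by rw [hB]; push_cast; rw [hPq]; ring
  have hCP : (C : ℚ) = P ^ 3 * P ^ n := by rw [hC]; push_cast; rw [hPq]; ring
  have hc0 : ∑ a : F × F, (1 : ℚ) = (P ^ 3 * (P ^ n) ^ 2) ^ 2 := by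
    simp only [Finset.sum_const, Finset.card_univ, Fintype.card_prod, nsmul_eq_mul, mul_one]
    push_cast
    rw [hFP]
    ring
  have hP0 : P ≠ 0 := by rw [← hPq]; exact_mod_cast (by omega : q ≠ 0)
  have hP1 : 1 < P := by rw [← hPq]; exact_mod_cast hq1
  have hP2 : P ^ 2 - 1 ≠ 0 := by nlinarith
  have x1 : P ^ (4 * n + 6) = P ^ 6 * (P ^ n) ^ 4 := by ring
  have x2 : P ^ (4 * n + 5) = P ^ 5 * (P ^ n) ^ 4 := by ring
  have x3 : P ^ (4 * n + 2) = P ^ 2 * (P ^ n) ^ 4 := by ring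
  have x4 : P ^ (2 * n) = (P ^ n) ^ 2 := by ring
  have x5 : P ^ (2 * n + 5) = P ^ 5 * (P ^ n) ^ 2 := by ring
  have x6 : P ^ (2 * n + 3) = P ^ 3 * (P ^ n) ^ 2 := by ring
  have x7 : P ^ (2 * n + 2) = P ^ 2 * (P ^ n) ^ 2 := by ring
  have x8 : P ^ (n + 1) = P * P ^ n := by ring
  have hx0 : P ^ n ≠ 0 := pow_ne_zero n hP0
  rw [x1, x2, x3, x4, x5, x6, x7, x8]
  generalize P ^ n = x at *
  rw [hc0] at k0
  push_cast at k1 k2 k3 k4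
  rw [hBP, hCP, hFP] at k1 k2 k3 k4
  rw [hPq] at k3 k4
  -- The odd moments involve only the differences `N(z) - N(-z)`, the even ones only the sums, so
  -- the system splits into two of size two; `t1` and `t2` eliminate `B`.
  have s1 : (N B - N (-B)) + P * (N C - N (-C)) = P ^ 4 * x ^ 3 := by
    apply mul_left_cancel₀ (mul_ne_zero (pow_ne_zero 2 hP0) hx0)
    linear_combination -k1
  have s3 : (N B - N (-B)) + P ^ 3 * (N C - N (-C)) = P * x * (P ^ 3 * x ^ 2 + P ^ 2 * x ^ 2 - 1) := by
    apply mul_left_cancel₀ (mul_ne_zero (pow_ne_zero 6 hP0) (pow_ne_zero 3 hx0))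
    linear_combination -k3
  have s2 : (N B + N (-B)) + P ^ 2 * (N C + N (-C)) = P ^ 5 * x ^ 4 := by
    apply mul_left_cancel₀ (mul_ne_zero (pow_ne_zero 4 hP0) (pow_ne_zero 2 hx0))
    linear_combination -k2
  have s4 : (N B + N (-B)) + P ^ 4 * (N C + N (-C)) =
      P ^ 2 * x ^ 2 * (P ^ 3 * x ^ 2 + P ^ 2 * x ^ 2 - 1) := by
    apply mul_left_cancel₀ (mul_ne_zero (pow_ne_zero 8 hP0) (pow_ne_zero 4 hx0))
    linear_combination -k4
  have t1 : (P ^ 2 - 1) * (N C - N (-C)) = x * (P ^ 2 * x ^ 2 - 1) := by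
    apply mul_left_cancel₀ hP0
    linear_combination s3 - s1
  have t2 : (P ^ 2 - 1) * (N C + N (-C)) = x ^ 2 * (P ^ 2 * x ^ 2 - 1) := by
    apply mul_left_cancel₀ (pow_ne_zero 2 hP0)
    linear_combination s4 - s2
  refine ⟨?_, ?_⟩
  · have := hcount 0
    rw [mul_zero] at this
    rw [this]
    linear_combination -k0 - s2 + t2
  · have c1 := hcount B
    have c2 := hcount (-B)
    have c3 := hcount C
    have c4 := hcount (-C)
    rintro ε (rfl | rfl)
    · rw [one_mul, one_mul, c1, c3]
      push_cast
      constructor <;> rw [eq_div_iff (mul_ne_zero two_ne_zero hP2)]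
      · linear_combination (P ^ 2 - 1) * (s1 + s2) - P * t1 - P ^ 2 * t2
      · linear_combination t1 + t2
    · rw [neg_one_mul, neg_one_mul, ← mul_neg, ← mul_neg, c2, c4]
      push_cast
      constructor <;> rw [eq_div_iff (mul_ne_zero two_ne_zero hP2)]
      · linear_combination (P ^ 2 - 1) * (s2 - s1) + P * t1 - P ^ 2 * t2
      · linear_combination t2 - t1

end Distribution

/-! ### Cyclic codes and their parity-check polynomials -/

section CyclicCodes

variable {K : Type*} [Field K]

theorem wordPoly_apply {n : ℕ} (c : Fin n → K) :
    wordPoly K n c = ∑ i : Fin n, Polynomial.monomial (i : ℕ) (c i) := by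
  simp [wordPoly]

theorem wordPoly_coeff {n : ℕ} (c : Fin n → K) (i : Fin n) : (wordPoly K n c).coeff i = c i := by
  rw [wordPoly_apply, Polynomial.finsetSum_coeff, Finset.sum_eq_single i]
  · simp
  · intro j _ hj
    rw [Polynomial.coeff_monomial, if_neg fun h => hj (Fin.ext h)]
  · simp

theorem wordPoly_degree_lt {n : ℕ} (c : Fin n → K) : (wordPoly K n c).degree < n := by
  rw [wordPoly_apply, Polynomial.degree_lt_iff_coeff_zero]
  intro j hj
  rw [Polynomial.finsetSum_coeff]
  refine Finset.sum_eq_zero fun i _ => ?_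
  rw [Polynomial.coeff_monomial, if_neg]
  have := i.2
  omega

theorem mk_mem_cyclicIdeal {n : ℕ} {g : K[X]} (hg : g ∣ X ^ n - 1) (f : K[X]) :
    Ideal.Quotient.mk (cyclicModulus K n) f ∈ cyclicIdeal n g ↔ g ∣ f := by
  rw [cyclicIdeal, Ideal.mem_span_singleton]
  constructor
  · rintro ⟨r, hr⟩
    obtain ⟨r, rfl⟩ := Ideal.Quotient.mk_surjective r
    rw [← map_mul, Ideal.Quotient.eq, cyclicModulus, Ideal.mem_span_singleton] at hr
    exact (dvd_sub_left (dvd_mul_right g r)).1 (hg.trans hr)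
  · exact map_dvd _

theorem mem_codeOfGenerator {n : ℕ} {g : K[X]} (hg : g ∣ X ^ n - 1) (c : Fin n → K) :
    c ∈ codeOfGenerator n g ↔ g ∣ wordPoly K n c :=
  mk_mem_cyclicIdeal hg _

theorem natDegree_X_pow_sub_one (n : ℕ) : (X ^ n - 1 : K[X]).natDegree = n := by
  rw [← Polynomial.C_1, Polynomial.natDegree_X_pow_sub_C]

theorem X_pow_sub_one_ne_zero {n : ℕ} (hn : 0 < n) : (X ^ n - 1 : K[X]) ≠ 0 := by
  rw [← Polynomial.C_1]
  exact Polynomial.X_pow_sub_C_ne_zero hn 1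

/-- Every codeword polynomial is `g s` with `deg s < deg h`. -/
theorem finrank_codeOfGenerator_le {n : ℕ} (hn : 0 < n) {g h : K[X]} (hgh : g * h = X ^ n - 1) :
    Module.finrank K (codeOfGenerator n g) ≤ h.natDegree := by
  have h0 := X_pow_sub_one_ne_zero (K := K) hn
  have hg0 : g ≠ 0 := fun h => h0 (by rw [← hgh, h, zero_mul])
  have hh0 : h ≠ 0 := fun h => h0 (by rw [← hgh, h, mul_zero])
  have hdeg : g.natDegree + h.natDegree = n := by
    rw [← Polynomial.natDegree_mul hg0 hh0, hgh, natDegree_X_pow_sub_one]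
  let φ : Polynomial.degreeLT K h.natDegree →ₗ[K] (Fin n → K) :=
    LinearMap.pi fun i => (Polynomial.lcoeff K (i : ℕ)) ∘ₗ (LinearMap.mulLeft K g) ∘ₗ
      (Polynomial.degreeLT K h.natDegree).subtype
  have hle : codeOfGenerator n g ≤ LinearMap.range φ := by
    intro c hc
    obtain ⟨s, hs⟩ := (mem_codeOfGenerator (Dvd.intro _ hgh) c).1 hc
    refine ⟨⟨s, ?_⟩, ?_⟩
    · rw [Polynomial.mem_degreeLT]
      by_cases hs0 : s = 0
      · rw [hs0, Polynomial.degree_zero]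
        exact WithBot.bot_lt_coe _
      · have h1 := wordPoly_degree_lt c
        rw [hs, Polynomial.degree_mul, Polynomial.degree_eq_natDegree hg0,
          Polynomial.degree_eq_natDegree hs0] at h1
        rw [Polynomial.degree_eq_natDegree hs0]
        have h2 : g.natDegree + s.natDegree < n := by exact_mod_cast h1
        exact_mod_cast (by omega : s.natDegree < h.natDegree)
    · funext i
      have h1 := wordPoly_coeff c i
      rw [hs] at h1
      exact h1
  calc Module.finrank K (codeOfGenerator n g) ≤ Module.finrank K (LinearMap.range φ) :=
        Submodule.finrank_mono hle
    _ ≤ Module.finrank K (Polynomial.degreeLT K h.natDegree) := LinearMap.finrank_range_le φ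
    _ = h.natDegree := by
        rw [(Polynomial.degreeLTEquiv K h.natDegree).finrank_eq, Module.finrank_fin_fun]

/-- A large enough space of words annihilated by `h` forces `h` to divide `Xⁿ - 1`, and is the
whole code with parity-check polynomial `h`. -/
theorem dvd_and_eq_codeOfParityCheck {n : ℕ} (hn : 0 < n) {h : K[X]} (hmon : h.Monic)
    (W : Submodule K (Fin n → K)) (hW : ∀ c ∈ W, (X ^ n - 1 : K[X]) ∣ h * wordPoly K n c)
    (hfin : h.natDegree ≤ Module.finrank K W) :
    h ∣ X ^ n - 1 ∧ codeOfParityCheck n h = W := by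
  classical
  have h0 := X_pow_sub_one_ne_zero (K := K) hn
  -- By Bézout, words annihilated by `h` modulo `Xⁿ - 1` are annihilated by `d`. Hence `deg h ≤ dim
  -- W ≤ deg d`, and `d ∣ h` makes the two associated.
  set d := EuclideanDomain.gcd h (X ^ n - 1) with hd
  have hdh : d ∣ h := EuclideanDomain.gcd_dvd_left _ _
  obtain ⟨g', hg'⟩ : d ∣ X ^ n - 1 := EuclideanDomain.gcd_dvd_right _ _
  have hd0 : d ≠ 0 := fun h => h0 (by rw [hg', h, zero_mul])
  have hWg' : W ≤ codeOfGenerator n g' := by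
    intro c hc
    rw [mem_codeOfGenerator (Dvd.intro_left _ hg'.symm)]
    have h1 : (X ^ n - 1 : K[X]) ∣ d * wordPoly K n c := by
      rw [hd, EuclideanDomain.gcd_eq_gcd_ab, add_mul]
      refine dvd_add ?_ ((dvd_mul_right _ _).mul_right _)
      rw [mul_right_comm]
      exact (hW c hc).mul_right _
    rw [hg'] at h1
    exact (mul_dvd_mul_iff_left hd0).1 h1
  have h2 : h.natDegree ≤ d.natDegree :=
    hfin.trans ((Submodule.finrank_mono hWg').trans
      (finrank_codeOfGenerator_le hn (by rw [mul_comm, hg'])))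
  have hdvd : h ∣ X ^ n - 1 := by
    have h3 : h ∣ d := (Polynomial.associated_of_dvd_of_natDegree_le hdh hmon.ne_zero h2).symm.dvd
    exact h3.trans (Dvd.intro _ hg'.symm)
  refine ⟨hdvd, ?_⟩
  have hg : (X ^ n - 1) /ₘ h * h = X ^ n - 1 := by
    rw [mul_comm]
    have := Polynomial.modByMonic_add_div (X ^ n - 1) h
    rwa [(Polynomial.modByMonic_eq_zero_iff_dvd hmon).2 hdvd, zero_add] at this
  symm
  refine Submodule.eq_of_le_of_finrank_le ?_ ((finrank_codeOfGenerator_le hn hg).trans hfin)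
  intro c hc
  rw [codeOfParityCheck, mem_codeOfGenerator (Dvd.intro _ hg)]
  have h1 := hW c hc
  rw [← hg, mul_comm h] at h1
  exact (mul_dvd_mul_iff_right hmon.ne_zero).1 h1

theorem isParityCheckPolynomial_codeOfParityCheck {n : ℕ} (hn : 0 < n) {h : K[X]}
    (hmon : h.Monic) (hdvd : h ∣ X ^ n - 1) :
    IsParityCheckPolynomial (codeOfParityCheck n h) h := by
  have hg : (X ^ n - 1) /ₘ h * h = X ^ n - 1 := by
    rw [mul_comm]
    have := Polynomial.modByMonic_add_div (X ^ n - 1) h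
    rwa [(Polynomial.modByMonic_eq_zero_iff_dvd hmon).2 hdvd, zero_add] at this
  refine ⟨_, ⟨?_, rfl, ?_⟩, hg⟩
  · refine hmon.of_mul_monic_right ?_
    rw [hg, ← Polynomial.C_1]
    exact Polynomial.monic_X_pow_sub_C 1 hn.ne'
  · intro f hf hmem
    exact Polynomial.natDegree_le_of_dvd ((mk_mem_cyclicIdeal (Dvd.intro _ hg) f).1 hmem) hf.ne_zero

end CyclicCodes

/-! ### Trace description of cyclic codes -/

section TraceWords

variable {K F : Type*} [Field K] [Field F] [Algebra K F] [FiniteDimensional K F]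

/-- The word with entries `Tr (∑ aᵢ γᵢᵗ)`. -/
noncomputable def traceWord (K : Type*) [Field K] [Algebra K F] {ι : Type*} [Fintype ι] (γ : ι → F)
    (n : ℕ) : (ι → F) →ₗ[K] (Fin n → K) where
  toFun a t := Algebra.trace K F (∑ i, a i * γ i ^ (t : ℕ))
  map_add' a b := by
    funext t
    simp [add_mul, Finset.sum_add_distrib]
  map_smul' r a := by
    funext t
    simp only [Pi.smul_apply, RingHom.id_apply, ← map_smul, Finset.smul_sum, smul_mul_assoc]

omit [FiniteDimensional K F] in
theorem traceWord_apply {ι : Type*} [Fintype ι] (γ : ι → F) {n : ℕ} (a : ι → F) (t : Fin n) :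
    traceWord K γ n a t = Algebra.trace K F (∑ i, a i * γ i ^ (t : ℕ)) := rfl

omit [FiniteDimensional K F] in
-- A shift replaces `aᵢ` by `aᵢγᵢ⁻¹`; the wrap-around is consistent because `γᵢⁿ = 1`.
theorem isCyclicCode_range_traceWord {ι : Type*} [Fintype ι] (γ : ι → F) {n : ℕ}
    (hγ : ∀ i, γ i ^ n = 1) (hγ0 : ∀ i, γ i ≠ 0) :
    IsCyclicCode (LinearMap.range (traceWord K γ n)) := by
  rintro _ ⟨a, rfl⟩
  refine ⟨fun i => a i * (γ i)⁻¹, ?_⟩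
  funext t
  obtain ⟨j, rfl⟩ := (finRotate n).surjective t
  rw [Equiv.symm_apply_apply, traceWord_apply, traceWord_apply]
  congr 1
  refine Finset.sum_congr rfl fun i _ => ?_
  have h : γ i ^ (finRotate n j : ℕ) = γ i * γ i ^ (j : ℕ) := by
    rcases n with _ | n
    · exact j.elim0
    · rw [coe_finRotate]
      split_ifs with hj
      · rw [hj, Fin.val_last, ← pow_succ', hγ, pow_zero]
      · rw [pow_succ']
  rw [h, mul_assoc, inv_mul_cancel_left₀ (hγ0 i)]

/-- Over `F` the trace splits the word polynomial into geometric sums of ratio `τ(γ)X`, one for each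
automorphism `τ`. The factor `τ(γ)X - 1` turns such a sum into `Xⁿ - 1`, and it divides the minimal
polynomial of `γ⁻¹`. -/
theorem X_pow_sub_one_dvd_minpoly_mul [IsGalois K F] {n : ℕ} {γ : F} (hγ : γ ^ n = 1) (hγ0 : γ ≠ 0)
    (a : F) : (X ^ n - 1 : K[X]) ∣
      minpoly K γ⁻¹ * wordPoly K n fun t => Algebra.trace K F (a * γ ^ (t : ℕ)) := by
  rw [← Polynomial.map_dvd_map' (algebraMap K F)]
  have h1 : (wordPoly K n fun t => Algebra.trace K F (a * γ ^ (t : ℕ))).map (algebraMap K F) =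
      ∑ τ : F ≃ₐ[K] F, Polynomial.C (τ a) *
        ∑ t ∈ Finset.range n, (Polynomial.C (τ γ) * X) ^ t := by
    rw [wordPoly_apply, Polynomial.map_sum]
    simp only [Polynomial.map_monomial, trace_eq_sum_automorphisms, map_sum, map_mul, map_pow]
    rw [Finset.sum_comm]
    refine Finset.sum_congr rfl fun τ _ => ?_
    rw [Finset.mul_sum, Finset.sum_range]
    refine Finset.sum_congr rfl fun t _ => ?_
    rw [← Polynomial.C_mul_X_pow_eq_monomial, mul_pow, Polynomial.C_mul, Polynomial.C_pow, mul_assoc]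
  rw [Polynomial.map_mul, h1, Finset.mul_sum]
  refine Finset.dvd_sum fun τ _ => ?_
  have h2 : (Polynomial.C (τ γ) * X - 1 : F[X]) ∣ (minpoly K γ⁻¹).map (algebraMap K F) := by
    have h3 : (X - Polynomial.C (τ γ)⁻¹ : F[X]) ∣ (minpoly K γ⁻¹).map (algebraMap K F) := by
      rw [Polynomial.dvd_iff_isRoot, Polynomial.IsRoot, Polynomial.eval_map_algebraMap, ← map_inv₀]
      have := minpoly.aeval K γ⁻¹
      rw [← AlgEquiv.coe_toAlgHom, Polynomial.aeval_algHom_apply, this, map_zero]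
    have h4 : (Polynomial.C (τ γ) * X - 1 : F[X]) =
        Polynomial.C (τ γ) * (X - Polynomial.C (τ γ)⁻¹) := by
      rw [mul_sub, ← Polynomial.C_mul, mul_inv_cancel₀ ((_root_.map_ne_zero τ).2 hγ0),
        Polynomial.C_1]
    rw [h4]
    exact (Polynomial.isUnit_C.2 ((_root_.map_ne_zero τ).2 hγ0).isUnit).mul_left_dvd.2 h3
  obtain ⟨r, hr⟩ := h2
  refine ⟨r * Polynomial.C (τ a), ?_⟩
  have h5 := geom_sum_mul (Polynomial.C (τ γ) * X : F[X]) n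
  rw [mul_pow, ← Polynomial.C_pow, ← map_pow, hγ, map_one, Polynomial.C_1, one_mul] at h5
  rw [hr, Polynomial.map_sub, Polynomial.map_pow, Polynomial.map_X, Polynomial.map_one, ← h5]
  ring

theorem X_pow_sub_one_dvd_prod_minpoly_mul [IsGalois K F] {ι : Type*} [Fintype ι] {γ : ι → F}
    {n : ℕ} (hγ : ∀ i, γ i ^ n = 1) (hγ0 : ∀ i, γ i ≠ 0) (a : ι → F) :
    (X ^ n - 1 : K[X]) ∣ (∏ i, minpoly K (γ i)⁻¹) * wordPoly K n (traceWord K γ n a) := by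
  have h : wordPoly K n (traceWord K γ n a) =
      ∑ i, wordPoly K n fun t => Algebra.trace K F (a i * γ i ^ (t : ℕ)) := by
    simp only [wordPoly_apply, traceWord_apply, map_sum]
    rw [Finset.sum_comm]
  rw [h, Finset.mul_sum]
  refine Finset.dvd_sum fun i _ => ?_
  have h1 := X_pow_sub_one_dvd_minpoly_mul (K := K) (hγ i) (hγ0 i) (a i)
  have h2 : minpoly K (γ i)⁻¹ ∣ ∏ i, minpoly K (γ i)⁻¹ :=
    Finset.dvd_prod_of_mem (fun i => minpoly K (γ i)⁻¹) (Finset.mem_univ i)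
  exact dvd_trans h1 (mul_dvd_mul_right h2 (wordPoly K n _))

/-- If the trace words are parametrized injectively, then they form the cyclic code with
parity-check polynomial `∏ minpoly (γᵢ⁻¹)`. -/
theorem codeOfParityCheck_prod_minpoly [IsGalois K F] {ι : Type*} [Fintype ι] {γ : ι → F} {n : ℕ}
    (hn : 0 < n) (hγ : ∀ i, γ i ^ n = 1) (hγ0 : ∀ i, γ i ≠ 0)
    (hinj : Function.Injective (traceWord K γ n)) :
    IsParityCheckPolynomial (codeOfParityCheck n (∏ i, minpoly K (γ i)⁻¹))
      (∏ i, minpoly K (γ i)⁻¹) ∧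
    codeOfParityCheck n (∏ i, minpoly K (γ i)⁻¹) = LinearMap.range (traceWord K γ n) := by
  have hmon : (∏ i, minpoly K (γ i)⁻¹).Monic :=
    Polynomial.monic_prod_of_monic _ _ fun i _ => minpoly.monic (Algebra.IsIntegral.isIntegral _)
  obtain ⟨h1, h2⟩ := dvd_and_eq_codeOfParityCheck hn hmon (LinearMap.range (traceWord K γ n))
    (by
      rintro _ ⟨a, rfl⟩
      exact X_pow_sub_one_dvd_prod_minpoly_mul hγ hγ0 a)
    (by
      -- The product has degree at most `|ι|·[F:K]`, the dimension of the space of trace words. No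
      -- separate proof that the minimal polynomials are distinct and of full degree is needed.
      rw [LinearMap.finrank_range_of_inj hinj, Module.finrank_pi_fintype,
        Polynomial.natDegree_prod_of_monic _ _
          fun i _ => minpoly.monic (Algebra.IsIntegral.isIntegral _)]
      exact Finset.sum_le_sum fun i _ => minpoly.natDegree_le _)
  exact ⟨isParityCheckPolynomial_codeOfParityCheck hn hmon h1, h2⟩

end TraceWords

/-! ### Powers of the Frobenius automorphism -/

section Frobenius

variable (p : ℕ) [Fact p.Prime] (F : Type*) [Field F] [Fintype F] [Algebra (ZMod p) F]

/-- The automorphism `x ↦ x ^ (p ^ k)`. -/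
noncomputable def frobPow (k : ℕ) : F ≃ₐ[ZMod p] F :=
  FiniteField.frobeniusAlgEquivOfAlgebraic (ZMod p) F ^ k

variable {p F}

theorem frobPow_apply (k : ℕ) (x : F) : frobPow p F k x = x ^ p ^ k := by
  rw [frobPow, AlgEquiv.coe_pow, FiniteField.coe_frobeniusAlgEquivOfAlgebraic_iterate, ZMod.card]

theorem frobPow_pow_finrank (k : ℕ) : frobPow p F k ^ Module.finrank (ZMod p) F = 1 := by
  rw [frobPow, pow_right_comm, ← FiniteField.orderOf_frobeniusAlgEquivOfAlgebraic (ZMod p) F,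
    pow_orderOf_eq_one, one_pow]

/-- Such an `x` has periods `k` and `[F:𝔽_p]` under the Frobenius map, hence period 1, so the whole
Galois group fixes it. -/
theorem exists_algebraMap_eq_of_frobPow_eq {k : ℕ} (h : Nat.gcd (Module.finrank (ZMod p) F) k = 1)
    (x : F) (hx : frobPow p F k x = x) : ∃ c : ZMod p, algebraMap (ZMod p) F c = x := by
  set φ := FiniteField.frobeniusAlgEquivOfAlgebraic (ZMod p) F with hφ
  have h1 : Function.IsPeriodicPt φ k x := by
    rw [Function.IsPeriodicPt, Function.IsFixedPt, ← AlgEquiv.coe_pow]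
    exact hx
  have h2 : Function.IsPeriodicPt φ (Module.finrank (ZMod p) F) x := by
    rw [Function.IsPeriodicPt, Function.IsFixedPt, ← AlgEquiv.coe_pow, hφ,
      ← FiniteField.orderOf_frobeniusAlgEquivOfAlgebraic (ZMod p) F, pow_orderOf_eq_one]
    rfl
  have h3 := h2.gcd h1
  rw [h] at h3
  have h4 : x ∈ (⊥ : IntermediateField (ZMod p) F) := by
    rw [IsGalois.mem_bot_iff_fixed]
    intro f
    obtain ⟨j, rfl⟩ := (FiniteField.bijective_frobeniusAlgEquivOfAlgebraic_pow (ZMod p) F).2 f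
    change (φ ^ (j : ℕ)) x = x
    rw [AlgEquiv.coe_pow]
    have := h3.const_mul (j : ℕ)
    rwa [mul_one] at this
  exact IntermediateField.mem_bot.1 h4

/-- Iterating `[F:𝔽_p]` times, an odd number, gives `x = -x`. -/
theorem eq_zero_of_frobPow_eq_neg (hp : p ≠ 2) {k : ℕ} (h : Odd (Module.finrank (ZMod p) F))
    (x : F) (hx : frobPow p F k x = -x) : x = 0 := by
  have h1 : ∀ j : ℕ, (frobPow p F k ^ j) x = (-1) ^ j * x := by
    intro j
    induction j with
    | zero => simp
    | succ j ih => rw [pow_succ, AlgEquiv.mul_apply, hx, map_neg, ih, pow_succ]; ring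
  have h2 := h1 (Module.finrank (ZMod p) F)
  rw [frobPow_pow_finrank, h.neg_one_pow, AlgEquiv.one_apply] at h2
  have hring : ringChar F ≠ 2 := by
    have : CharP F p := charP_of_injective_algebraMap (algebraMap (ZMod p) F).injective p
    rwa [ringChar.eq F p]
  have h3 : (2 : F) * x = 0 := by linear_combination h2
  exact (mul_eq_zero.1 h3).resolve_left (Ring.two_ne_zero hring)

end Frobenius

/-! ### Weights of trace words -/

section Weights

theorem sum_range_two_mul (f : ℕ → ℕ) (M : ℕ) :
    ∑ t ∈ Finset.range (2 * M), f t = ∑ s ∈ Finset.range M, (f (2 * s) + f (2 * s + 1)) := by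
  induction M with
  | zero => simp
  | succ M ih =>
    rw [Nat.mul_succ, Finset.sum_range_succ, Finset.sum_range_succ, ih, Finset.sum_range_succ]
    ring

section Generator

variable {F : Type*} [Field F] [Fintype F] {π : Fˣ} (hπ : Subgroup.zpowers π = ⊤)
include hπ

theorem orderOf_generator : orderOf π = Fintype.card F - 1 := by
  classical
  rw [orderOf_eq_card_of_forall_mem_zpowers (fun x => hπ ▸ Subgroup.mem_top x),
    Nat.card_eq_fintype_card, Fintype.card_units]

theorem sum_range_generator_pow (f : F → ℕ) :
    ∑ s ∈ Finset.range (Fintype.card F - 1), f ((π : F) ^ s) + f 0 = ∑ x, f x := by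
  classical
  rw [← Finset.sum_erase_add _ _ (Finset.mem_univ (0 : F))]
  congr 1
  refine Finset.sum_nbij (fun s => (π : F) ^ s) ?_ ?_ ?_ fun _ _ => rfl
  · intro s _
    simp
  · intro s hs t ht h
    have hs' : s < orderOf π := by rw [orderOf_generator hπ]; simpa using hs
    have ht' : t < orderOf π := by rw [orderOf_generator hπ]; simpa using ht
    have h' : (π : F) ^ s = (π : F) ^ t := h
    exact pow_injOn_Iio_orderOf hs' ht' (Units.ext (by simpa using h'))
  · intro x hx
    have hx0 : x ≠ 0 := by simpa using hx
    have h1 : Units.mk0 x hx0 ∈ Finset.image (fun i => π ^ i) (Finset.range (orderOf π)) := by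
      rw [IsCyclic.image_range_orderOf (fun x => hπ ▸ Subgroup.mem_top x)]
      exact Finset.mem_univ _
    obtain ⟨s, hs, h⟩ := Finset.mem_image.1 h1
    refine ⟨s, by rwa [← orderOf_generator hπ], ?_⟩
    simpa using congrArg Units.val h

theorem generator_pow_half {M : ℕ} (hM : Fintype.card F - 1 = 2 * M) (hM0 : 0 < M) :
    (π : F) ^ M = -1 := by
  have h1 : ((π : F) ^ M) ^ 2 = 1 := by
    rw [← pow_mul, mul_comm, ← hM, ← orderOf_generator hπ, ← Units.val_pow_eq_pow_val,
      pow_orderOf_eq_one, Units.val_one]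
  rcases sq_eq_sq_iff_eq_or_eq_neg.1 (h1.trans (one_pow 2).symm) with h | h
  · exfalso
    have h2 : π ^ M = 1 := Units.ext (by simpa using h)
    have h3 := orderOf_dvd_of_pow_eq_one h2
    rw [orderOf_generator hπ, hM] at h3
    have := Nat.le_of_dvd hM0 h3
    omega
  · exact h

/-- Since `π^(s+M) = -π^s`, the first `M` powers of `π` represent the nonzero elements modulo sign.
-/
theorem two_mul_sum_range_generator_pow {M : ℕ} (hM : Fintype.card F - 1 = 2 * M) (hM0 : 0 < M)
    (f : F → ℕ) (hf : ∀ x, f (-x) = f x) :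
    2 * ∑ s ∈ Finset.range M, f ((π : F) ^ s) + f 0 = ∑ x, f x := by
  rw [← sum_range_generator_pow hπ, hM, two_mul M, Finset.sum_range_add, two_mul]
  congr 2
  refine Finset.sum_congr rfl fun s _ => ?_
  rw [pow_add, generator_pow_half hπ hM hM0, neg_one_mul, hf]

theorem two_mul_card_mul_sum_range {K : Type*} [Field K] [Fintype K] [DecidableEq K] [Algebra K F]
    (σ : F ≃ₐ[K] F) (u v w : F)
    {M : ℕ} (hM : Fintype.card F - 1 = 2 * M) (hM0 : 0 < M) :
    (2 * Fintype.card K *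
      ∑ s ∈ Finset.range M, (if twistedForm σ u v w ((π : F) ^ s) ≠ 0 then 1 else 0 : ℕ) : ℤ) =
      (Fintype.card K - 1) * Fintype.card F - totalSum σ u v w := by
  have h1 := two_mul_sum_range_generator_pow hπ hM hM0
    (fun x => if twistedForm σ u v w x ≠ 0 then 1 else 0) (fun x => by simp)
  simp only [QuadraticMap.map_zero, ne_eq, not_true_eq_false, if_false, add_zero] at h1
  have h2 := Finset.card_filter_add_card_filter_not (s := (Finset.univ : Finset F))
    (fun x => twistedForm σ u v w x = 0)
  rw [Finset.card_univ, Finset.card_filter (fun x => ¬twistedForm σ u v w x = 0), ← h1] at h2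
  rw [totalSum]
  simp only [ne_eq] at h2 ⊢
  zify at h2
  push_cast
  linear_combination (Fintype.card K : ℤ) * h2

end Generator

variable {K F : Type*} [Field K] [Fintype K] [DecidableEq K] [Field F] [Fintype F] [Algebra K F]

/-- The five exponential bases of the trace words, for `c = π ^ e₁` and `d = π ^ e₂`. -/
def fiveBases (b c d : F) : Fin 5 → F := ![b, -b, c, -c, d]

/-- The coefficients of the forms seen at the even and at the odd positions of a trace word. -/
def formCoordinates (h2 : (2 : F) ≠ 0) {b c : F} (hb : b ≠ 0) (hc : c ≠ 0) :
    (Fin 5 → F) ≃ F × (F × F) × (F × F) where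
  toFun a := (a 4, (a 0 + a 1, a 2 + a 3), ((a 0 - a 1) * b, (a 2 - a 3) * c))
  invFun r := ![(r.2.1.1 + r.2.2.1 / b) / 2, (r.2.1.1 - r.2.2.1 / b) / 2,
    (r.2.1.2 + r.2.2.2 / c) / 2, (r.2.1.2 - r.2.2.2 / c) / 2, r.1]
  left_inv a := by
    funext i
    fin_cases i <;> simp <;> field_simp <;> ring
  right_inv r := by
    ext <;> simp <;> field_simp <;> ring

/-- At `x = π^s` the monomials `x²`, `xσ(x)`, `xσ²(x)` are `π^(2s)`, `π^(2e₁s)`, `π^(2e₂s)`, so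
position `2s` evaluates a form at `π^s`. At position `2s + 1` the bases with a minus sign change
sign, and factors `π`, `π^e₁`, `π^e₂` are left over for the coefficients. -/
theorem two_mul_card_mul_hammingNorm {π : Fˣ} (hπ : Subgroup.zpowers π = ⊤) (σ : F ≃ₐ[K] F)
    {j e₁ e₂ : ℕ} (hσ : ∀ x, σ x = x ^ j) (h1 : j + 1 = 2 * e₁) (h2 : j ^ 2 + 1 = 2 * e₂)
    {n M : ℕ} (hn : n = Fintype.card F - 1) (hM : Fintype.card F - 1 = 2 * M) (hM0 : 0 < M)
    (a : Fin 5 → F) :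
    (2 * Fintype.card K * hammingNorm
      (traceWord K (fiveBases (π : F) ((π : F) ^ e₁) ((π : F) ^ e₂)) n a) : ℤ) =
      2 * (Fintype.card K - 1) * Fintype.card F -
        totalSum σ (a 0 + a 1) (a 2 + a 3) (a 4) -
        totalSum σ ((a 0 - a 1) * π) ((a 2 - a 3) * (π : F) ^ e₁) (a 4 * (π : F) ^ e₂) := by
  have hσσ : ∀ x, σ (σ x) = x ^ j ^ 2 := fun x => by rw [hσ, hσ, ← pow_mul, sq]
  set c : ℕ → K := fun t => Algebra.trace K F
    (∑ i, a i * fiveBases (π : F) ((π : F) ^ e₁) ((π : F) ^ e₂) i ^ t) with hc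
  have hnorm : hammingNorm (traceWord K (fiveBases (π : F) ((π : F) ^ e₁) ((π : F) ^ e₂)) n a) =
      ∑ t ∈ Finset.range (2 * M), if c t ≠ 0 then 1 else 0 := by
    rw [← hM, ← hn, hammingNorm, Finset.card_filter, Finset.sum_range]
    rfl
  have hx : ∀ x : F, x * σ x = x ^ (2 * e₁) := fun x => by rw [hσ, ← pow_succ', h1]
  have hxx : ∀ x : F, x * σ (σ x) = x ^ (2 * e₂) := fun x => by rw [hσσ, ← pow_succ', h2]
  have heven : ∀ s, c (2 * s) =
      twistedForm σ (a 0 + a 1) (a 2 + a 3) (a 4) ((π : F) ^ s) := by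
    intro s
    rw [hc, twistedForm_apply, hx, hxx]
    simp only [Fin.sum_univ_five, fiveBases]
    congr 1
    simp only [Matrix.cons_val, (even_two_mul s).neg_pow]
    ring
  have hodd : ∀ s, c (2 * s + 1) =
      twistedForm σ ((a 0 - a 1) * π) ((a 2 - a 3) * (π : F) ^ e₁) (a 4 * (π : F) ^ e₂)
        ((π : F) ^ s) := by
    intro s
    rw [hc, twistedForm_apply, hx, hxx]
    simp only [Fin.sum_univ_five, fiveBases]
    congr 1
    simp only [Matrix.cons_val, (odd_two_mul_add_one s).neg_pow]
    ring
  rw [hnorm, sum_range_two_mul, Finset.sum_add_distrib]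
  simp only [heven, hodd]
  have k1 := two_mul_card_mul_sum_range hπ σ (a 0 + a 1) (a 2 + a 3) (a 4) hM hM0
  have k2 := two_mul_card_mul_sum_range hπ σ ((a 0 - a 1) * π) ((a 2 - a 3) * (π : F) ^ e₁)
    (a 4 * (π : F) ^ e₂) hM hM0
  push_cast at k1 k2 ⊢
  linear_combination k1 + k2

end Weights

/-! ### The weight table as a convolution -/

section Table

theorem tableFrequency_eq (T : List (ℚ × ℚ)) (i : ℕ) :
    tableFrequency T i = (T.map fun r => r.2 * if r.1 = (i : ℚ) then 1 else 0).sum := by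
  induction T with
  | nil => simp [tableFrequency]
  | cons r T ih =>
    rw [List.map_cons, List.sum_cons, ← ih, tableFrequency, tableFrequency]
    by_cases h : r.1 = (i : ℚ) <;> simp [h]

/-- Expansion of a double sum over the values `a, 0, b, -b` (for `w = 0`) and `0, b, -b, c, -c`
(for `w ≠ 0`) into the rows of the weight table. -/
theorem double_sum_eq_weightTable (δ : ℚ → ℚ) (p m : ℕ) (a b c Q n0 nP nM n0s nP1 nM1 nP3 nM3 : ℚ)
    (ha : a = (p : ℚ) ^ (m - 1)) (hb : b = (p : ℚ) ^ ((m - 1) / 2))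
    (hc : c = (p : ℚ) ^ ((m + 1) / 2)) (hQ : Q = (p : ℚ) ^ m - 1) (E₀ E₁ : (ℚ → ℚ) → ℚ)
    (hE₀ : ∀ f, E₀ f = f a + (n0 * f 0 + (nP * f b + nM * f (-b))))
    (hE₁ : ∀ f, E₁ f = n0s * f 0 + (nP1 * f b + (nM1 * f (-b) + (nP3 * f c + nM3 * f (-c))))) :
    (E₀ fun t => E₀ fun t' => δ (((p : ℚ) - 1) * (a - (t + t') / 2))) +
      Q * (E₁ fun t => E₁ fun t' => δ (((p : ℚ) - 1) * (a - (t + t') / 2))) =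
      ((weightTable p m n0 nP nM n0s nP1 nM1 nP3 nM3).map fun r => r.2 * δ r.1).sum := by
  simp only [hE₀, hE₁, weightTable, List.map_cons, List.map_nil, List.sum_cons, List.sum_nil,
    ← ha, ← hb, ← hc, ← hQ]
  clear ha hb hc hQ
  generalize (p : ℚ) = P
  -- Normalizing the arguments of `δ` identifies the terms of equal weight in the two expanded
  -- double sums and collects them into rows.
  ring_nf

end Table

/-! ### Bounds for the values and sums over them -/

section ValueSums

variable {K F : Type*} [Field K] [Fintype K] [DecidableEq K] [Field F] [Fintype F] [DecidableEq F]
  [Algebra K F] [FiniteDimensional K F] [Algebra.IsSeparable K F]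

variable (hK : ringChar K ≠ 2) {χ : AddChar K ℂ} (hχ : χ.IsPrimitive) {σ : F ≃ₐ[K] F}
  (hfix : ∀ x, σ x = x → ∃ c : K, algebraMap K F c = x)
  {n : ℕ} (hn : Module.finrank K F = 2 * n + 3)
include hK hχ hfix hn

theorem totalSum_values {u v w : F} (h : ¬(u = 0 ∧ v = 0 ∧ w = 0)) :
    totalSum σ u v w = 0 ∨ totalSum σ u v w = (Fintype.card K - 1) * Fintype.card K ^ (n + 2) ∨
      totalSum σ u v w = -((Fintype.card K - 1) * Fintype.card K ^ (n + 2)) ∨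
      (w ≠ 0 ∧ (totalSum σ u v w = (Fintype.card K - 1) * Fintype.card K ^ (n + 3) ∨
        totalSum σ u v w = -((Fintype.card K - 1) * Fintype.card K ^ (n + 3)))) := by
  obtain ⟨e, he, -, h⟩ := exists_normalized_totalSum hK hχ hfix hn h
  rw [he]
  rcases h with rfl | (rfl | rfl) | ⟨hw, rfl | rfl⟩ <;> simp [*]

theorem totalSum_le_of_ne_zero {u v w : F} (h : ¬(u = 0 ∧ v = 0 ∧ w = 0)) :
    totalSum σ u v w ≤ (Fintype.card K - 1) * Fintype.card K ^ (n + 3) := by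
  have hq : (1 : ℤ) < Fintype.card K := by exact_mod_cast Fintype.one_lt_card (α := K)
  have h1 : (0 : ℤ) < (Fintype.card K - 1) * Fintype.card K ^ (n + 2) :=
    mul_pos (by linarith) (by positivity)
  have h2 : ((Fintype.card K : ℤ) - 1) * Fintype.card K ^ (n + 2) ≤
      (Fintype.card K - 1) * Fintype.card K ^ (n + 3) :=
    mul_le_mul_of_nonneg_left (pow_le_pow_right₀ hq.le (by omega)) (by linarith)
  rcases totalSum_values hK hχ hfix hn h with h | h | h | ⟨-, h | h⟩ <;> linarith

theorem totalSum_le_of_eq_zero {u v : F} (h : ¬(u = 0 ∧ v = 0)) :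
    totalSum σ u v 0 ≤ (Fintype.card K - 1) * Fintype.card K ^ (n + 2) := by
  have hq : (1 : ℤ) < Fintype.card K := by exact_mod_cast Fintype.one_lt_card (α := K)
  have h1 : (0 : ℤ) < (Fintype.card K - 1) * Fintype.card K ^ (n + 2) :=
    mul_pos (by linarith) (by positivity)
  rcases totalSum_values hK hχ hfix hn (u := u) (v := v) (w := 0) (fun h' => h ⟨h'.1, h'.2.1⟩)
    with h | h | h | ⟨h, -⟩
  · linarith
  · linarith
  · linarith
  · exact absurd rfl h

/-- Here `n > 0`, that is `m ≥ 5`, is essential: it puts `|K|^(n+3)` below `|F|`, so that only the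
zero form attains the maximal value. -/
theorem totalSum_lt (hn0 : 0 < n) {u v w : F} (h : ¬(u = 0 ∧ v = 0 ∧ w = 0)) :
    totalSum σ u v w < (Fintype.card K - 1) * Fintype.card F := by
  have hq : (1 : ℤ) < Fintype.card K := by exact_mod_cast Fintype.one_lt_card (α := K)
  have hF : Fintype.card F = Fintype.card K ^ (2 * n + 3) := by
    rw [← hn]; exact Module.card_eq_pow_finrank
  refine (totalSum_le_of_ne_zero hK hχ hfix hn h).trans_lt ?_
  rw [hF]
  push_cast
  exact mul_lt_mul_of_pos_left (pow_lt_pow_right₀ hq (by omega)) (by linarith)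

omit [DecidableEq F] in
theorem sum_totalSum_zero (hn0 : 0 < n) (f : ℤ → ℚ) :
    ∑ a : F × F, f (totalSum σ a.1 a.2 0) =
      f ((Fintype.card K - 1) * Fintype.card F) + (totalSumCount σ (0 : F) 0 * f 0 +
      (totalSumCount σ (0 : F) ((Fintype.card K - 1) * Fintype.card K ^ (n + 2)) *
        f ((Fintype.card K - 1) * Fintype.card K ^ (n + 2)) +
      totalSumCount σ (0 : F) (-((Fintype.card K - 1) * Fintype.card K ^ (n + 2))) *
        f (-((Fintype.card K - 1) * Fintype.card K ^ (n + 2))))) := by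
  classical
  have hq : (1 : ℤ) < Fintype.card K := by exact_mod_cast Fintype.one_lt_card (α := K)
  have hB : (0 : ℤ) < (Fintype.card K - 1) * Fintype.card K ^ (n + 2) :=
    mul_pos (by linarith) (by positivity)
  have hQ : ((Fintype.card K : ℤ) - 1) * Fintype.card K ^ (n + 2) <
      (Fintype.card K - 1) * Fintype.card F := by
    have hF : Fintype.card F = Fintype.card K ^ (2 * n + 3) := by
      rw [← hn]; exact Module.card_eq_pow_finrank
    rw [hF]
    push_cast
    exact mul_lt_mul_of_pos_left (pow_lt_pow_right₀ hq (by omega)) (by linarith)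
  have hlt : ∀ a : F × F, a ≠ 0 → totalSum σ a.1 a.2 0 < (Fintype.card K - 1) * Fintype.card F :=
    fun a ha => totalSum_lt hK hχ hfix hn hn0 fun h => ha (Prod.ext h.1 h.2.1)
  have hval : ∀ a : F × F, a ≠ 0 → totalSum σ a.1 a.2 0 = 0 ∨
      totalSum σ a.1 a.2 0 = (Fintype.card K - 1) * Fintype.card K ^ (n + 2) ∨
      totalSum σ a.1 a.2 0 = -((Fintype.card K - 1) * Fintype.card K ^ (n + 2)) := by
    intro a ha
    rcases totalSum_values hK hχ hfix hn (u := a.1) (v := a.2) (w := 0)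
      (fun h => ha (Prod.ext h.1 h.2.1)) with h | h | h | ⟨h, -⟩
    · exact Or.inl h
    · exact Or.inr (Or.inl h)
    · exact Or.inr (Or.inr h)
    · exact absurd rfl h
  have h0 : totalSum σ (0 : F × F).1 (0 : F × F).2 0 =
      (Fintype.card K - 1) * Fintype.card F := totalSum_zero σ
  unfold totalSumCount
  generalize ((Fintype.card K : ℤ) - 1) * Fintype.card K ^ (n + 2) = B at *
  generalize ((Fintype.card K : ℤ) - 1) * Fintype.card F = Q at *
  rw [Finset.sum_comp_eq_sum_card (fun a : F × F => totalSum σ a.1 a.2 0) {Q, 0, B, -B} ?_ f,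
    Finset.sum_insert, Finset.sum_insert, Finset.sum_insert, Finset.sum_singleton]
  · congr 1
    have : (Finset.univ.filter fun a : F × F => totalSum σ a.1 a.2 0 = Q) = {0} := by
      ext a
      simp only [Finset.mem_filter, Finset.mem_univ, true_and, Finset.mem_singleton]
      constructor
      · intro h
        by_contra ha
        exact (hlt a ha).ne h
      · rintro rfl
        exact h0
    rw [this, Finset.card_singleton, Nat.cast_one, one_mul]
  · simp only [Finset.mem_singleton]; omega
  · simp only [Finset.mem_insert, Finset.mem_singleton]; omega
  · simp only [Finset.mem_insert, Finset.mem_singleton]; omega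
  · intro a
    simp only [Finset.mem_insert, Finset.mem_singleton]
    by_cases ha : a = 0
    · rw [ha]
      exact Or.inl h0
    · exact Or.inr (hval a ha)

variable (hneg : ∀ x, σ x = -x → x = 0)
include hneg

omit [DecidableEq F] in
-- The formulas of `totalSumCount_ne_zero` do not involve `w`, so the counts at `w` may be replaced
-- by those at a reference point `w₀`.
theorem sum_totalSum_of_ne_zero {w w₀ : F} (hw : w ≠ 0) (hw₀ : w₀ ≠ 0) (f : ℤ → ℚ) :
    ∑ a : F × F, f (totalSum σ a.1 a.2 w) =
      totalSumCount σ w₀ 0 * f 0 +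
      (totalSumCount σ w₀ ((Fintype.card K - 1) * Fintype.card K ^ (n + 2)) *
        f ((Fintype.card K - 1) * Fintype.card K ^ (n + 2)) +
      (totalSumCount σ w₀ (-((Fintype.card K - 1) * Fintype.card K ^ (n + 2))) *
        f (-((Fintype.card K - 1) * Fintype.card K ^ (n + 2))) +
      (totalSumCount σ w₀ ((Fintype.card K - 1) * Fintype.card K ^ (n + 3)) *
        f ((Fintype.card K - 1) * Fintype.card K ^ (n + 3)) +
      totalSumCount σ w₀ (-((Fintype.card K - 1) * Fintype.card K ^ (n + 3))) *
        f (-((Fintype.card K - 1) * Fintype.card K ^ (n + 3)))))) := by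
  classical
  have hq : (1 : ℤ) < Fintype.card K := by exact_mod_cast Fintype.one_lt_card (α := K)
  have hB : (0 : ℤ) < (Fintype.card K - 1) * Fintype.card K ^ (n + 2) :=
    mul_pos (by linarith) (by positivity)
  have hBC : ((Fintype.card K : ℤ) - 1) * Fintype.card K ^ (n + 2) <
      (Fintype.card K - 1) * Fintype.card K ^ (n + 3) :=
    mul_lt_mul_of_pos_left (pow_lt_pow_right₀ hq (by omega)) (by linarith)
  have hval := fun a : F × F => totalSum_values hK hχ hfix hn (u := a.1) (v := a.2) (w := w)
      (fun h => hw h.2.2)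
  obtain ⟨c0, c⟩ := totalSumCount_ne_zero hK hχ hfix hneg hn _ rfl hw
  obtain ⟨d0, d⟩ := totalSumCount_ne_zero hK hχ hfix hneg hn _ rfl hw₀
  have c1 := c 1 (Or.inl rfl)
  have c2 := c (-1) (Or.inr rfl)
  have d1 := d 1 (Or.inl rfl)
  have d2 := d (-1) (Or.inr rfl)
  simp only [one_mul, neg_one_mul] at c1 c2 d1 d2
  rw [d0, d1.1, d1.2, d2.1, d2.2, ← c0, ← c1.1, ← c1.2, ← c2.1, ← c2.2]
  unfold totalSumCount
  generalize ((Fintype.card K : ℤ) - 1) * Fintype.card K ^ (n + 2) = B at *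
  generalize ((Fintype.card K : ℤ) - 1) * Fintype.card K ^ (n + 3) = C at *
  rw [Finset.sum_comp_eq_sum_card (fun a : F × F => totalSum σ a.1 a.2 w) {0, B, -B, C, -C} ?_ f,
    Finset.sum_insert, Finset.sum_insert, Finset.sum_insert, Finset.sum_insert,
    Finset.sum_singleton]
  · simp only [Finset.mem_singleton]; omega
  · simp only [Finset.mem_insert, Finset.mem_singleton]; omega
  · simp only [Finset.mem_insert, Finset.mem_singleton]; omega
  · simp only [Finset.mem_insert, Finset.mem_singleton]; omega
  · intro a
    simp only [Finset.mem_insert, Finset.mem_singleton]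
    rcases hval a with h | h | h | ⟨-, h | h⟩ <;> simp [h]

end ValueSums

/-! ### Weight distribution and parameters of the trace code -/

section TraceCode

variable {K F : Type*} [Field K] [Fintype K] [DecidableEq K] [Field F] [Fintype F] [DecidableEq F]
  [Algebra K F] [FiniteDimensional K F] [Algebra.IsSeparable K F]

variable (hK : ringChar K ≠ 2) {χ : AddChar K ℂ} (hχ : χ.IsPrimitive) {σ : F ≃ₐ[K] F}
  (hfix : ∀ x, σ x = x → ∃ c : K, algebraMap K F c = x)
  {n : ℕ} (hn : Module.finrank K F = 2 * n + 3) (hn0 : 0 < n)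
  {π : Fˣ} (hπ : Subgroup.zpowers π = ⊤)
  {j e₁ e₂ : ℕ} (hσ : ∀ x, σ x = x ^ j) (h1 : j + 1 = 2 * e₁) (h2 : j ^ 2 + 1 = 2 * e₂)
  {N M : ℕ} (hN : N = Fintype.card F - 1) (hM : Fintype.card F - 1 = 2 * M) (hM0 : 0 < M)

omit [DecidableEq F] [FiniteDimensional K F] [Algebra.IsSeparable K F] in
include hπ hσ h1 h2 hN hM hM0 in
-- `formCoordinates` turns codewords into triples of `w` and two independent pairs; the form at the
-- odd positions has last coefficient `w π^e₂`.
theorem weightCount_range_traceWord (hF2 : (2 : F) ≠ 0)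
    (hinj : Function.Injective
      (traceWord K (fiveBases (π : F) ((π : F) ^ e₁) ((π : F) ^ e₂)) N)) (i : ℕ) :
    (weightCount (LinearMap.range
      (traceWord K (fiveBases (π : F) ((π : F) ^ e₁) ((π : F) ^ e₂)) N)) i : ℚ) =
    ∑ w : F, ∑ b : F × F, ∑ b' : F × F,
      if (2 * ((Fintype.card K : ℚ) - 1) * Fintype.card F - totalSum σ b.1 b.2 w -
        totalSum σ b'.1 b'.2 (w * (π : F) ^ e₂)) / (2 * Fintype.card K) = i then 1 else 0 := by
  classical
  set L := traceWord K (fiveBases (π : F) ((π : F) ^ e₁) ((π : F) ^ e₂)) N with hL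
  set e := formCoordinates hF2 π.ne_zero (pow_ne_zero e₁ π.ne_zero) with he
  have hq : (Fintype.card K : ℚ) ≠ 0 := by exact_mod_cast Fintype.card_ne_zero
  have hcond : ∀ r : F × (F × F) × (F × F), hammingNorm (L (e.symm r)) = i ↔
      (2 * ((Fintype.card K : ℚ) - 1) * Fintype.card F - totalSum σ r.2.1.1 r.2.1.2 r.1 -
        totalSum σ r.2.2.1 r.2.2.2 (r.1 * (π : F) ^ e₂)) / (2 * Fintype.card K) = i := by
    intro r
    have hw := two_mul_card_mul_hammingNorm hπ σ hσ h1 h2 hN hM hM0 (e.symm r)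
    have hr := e.apply_symm_apply r
    generalize e.symm r = a at *
    subst hr
    have hw' := congrArg (Int.cast : ℤ → ℚ) hw
    push_cast at hw'
    rw [div_eq_iff (mul_ne_zero two_ne_zero hq)]
    change _ ↔ 2 * ((Fintype.card K : ℚ) - 1) * Fintype.card F -
      totalSum σ (a 0 + a 1) (a 2 + a 3) (a 4) -
      totalSum σ ((a 0 - a 1) * π) ((a 2 - a 3) * (π : F) ^ e₁) (a 4 * (π : F) ^ e₂) = _
    rw [← hw', mul_comm (i : ℚ), mul_right_inj' (mul_ne_zero two_ne_zero hq)]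
    exact Nat.cast_inj.symm
  have hset : {c | c ∈ LinearMap.range L ∧ hammingNorm c = i} =
      (fun r => L (e.symm r)) '' {r | hammingNorm (L (e.symm r)) = i} := by
    ext c
    constructor
    · rintro ⟨⟨a, rfl⟩, ha⟩
      exact ⟨e a, by simpa using ha, by simp⟩
    · rintro ⟨r, hr, rfl⟩
      exact ⟨⟨_, rfl⟩, hr⟩
  have hinj' : Function.Injective fun r => L (e.symm r) := hinj.comp e.symm.injective
  rw [weightCount, hset, Set.ncard_image_of_injective _ hinj']
  simp only [hcond]
  rw [Set.ncard_eq_toFinset_card', Set.toFinset_ofPred, Finset.card_filter]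
  push_cast
  simp only [Fintype.sum_prod_type]

omit [DecidableEq F] in
include hK hχ hfix hn hn0 hπ hσ h1 h2 hN hM hM0 in
-- A zero word forces both total sums to be maximal, so both forms have zero coefficients, and these
-- determine `a`.
theorem traceWord_fiveBases_injective :
    Function.Injective (traceWord K (fiveBases (π : F) ((π : F) ^ e₁) ((π : F) ^ e₂)) N) := by
  classical
  rw [injective_iff_map_eq_zero]
  intro a ha
  have hw := two_mul_card_mul_hammingNorm hπ σ hσ h1 h2 hN hM hM0 a
  rw [ha, hammingNorm_zero] at hw
  have hle : ∀ u v w : F, totalSum σ u v w ≤ (Fintype.card K - 1) * Fintype.card F := by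
    intro u v w
    by_cases h : u = 0 ∧ v = 0 ∧ w = 0
    · obtain ⟨rfl, rfl, rfl⟩ := h
      exact (totalSum_zero σ).le
    · exact (totalSum_lt hK hχ hfix hn hn0 h).le
  have k1 := hle (a 0 + a 1) (a 2 + a 3) (a 4)
  have k2 := hle ((a 0 - a 1) * π) ((a 2 - a 3) * (π : F) ^ e₁) (a 4 * (π : F) ^ e₂)
  rw [Nat.cast_zero, mul_zero] at hw
  have z1 : a 0 + a 1 = 0 ∧ a 2 + a 3 = 0 ∧ a 4 = 0 := by
    by_contra h
    linarith [totalSum_lt hK hχ hfix hn hn0 h]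
  have z2 : (a 0 - a 1) * π = 0 ∧ (a 2 - a 3) * (π : F) ^ e₁ = 0 ∧ a 4 * (π : F) ^ e₂ = 0 := by
    by_contra h
    linarith [totalSum_lt hK hχ hfix hn hn0 h]
  have hF2 : (2 : F) ≠ 0 := by
    rw [← map_ofNat (algebraMap K F) 2]
    exact (_root_.map_ne_zero _).2 (Ring.two_ne_zero hK)
  have e1 : a 0 - a 1 = 0 := (mul_eq_zero.1 z2.1).resolve_right π.ne_zero
  have e2 : a 2 - a 3 = 0 := (mul_eq_zero.1 z2.2.1).resolve_right (pow_ne_zero _ π.ne_zero)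
  funext i
  fin_cases i
  · exact (mul_eq_zero.1 (by linear_combination z1.1 + e1 : 2 * a 0 = 0)).resolve_left hF2
  · exact (mul_eq_zero.1 (by linear_combination z1.1 - e1 : 2 * a 1 = 0)).resolve_left hF2
  · exact (mul_eq_zero.1 (by linear_combination z1.2.1 + e2 : 2 * a 2 = 0)).resolve_left hF2
  · exact (mul_eq_zero.1 (by linear_combination z1.2.1 - e2 : 2 * a 3 = 0)).resolve_left hF2
  · exact z1.2.2

omit [DecidableEq F] in
include hK hχ hfix hn hn0 hπ hσ h1 h2 hN hM hM0 in
theorem weightCount_eq_tableFrequency (hneg : ∀ x, σ x = -x → x = 0) {w₀ : F} (hw₀ : w₀ ≠ 0)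
    (i : ℕ) :
    (weightCount (LinearMap.range
      (traceWord K (fiveBases (π : F) ((π : F) ^ e₁) ((π : F) ^ e₂)) N)) i : ℚ) =
    tableFrequency (weightTable (Fintype.card K) (2 * n + 3)
      (totalSumCount σ (0 : F) 0)
      (totalSumCount σ (0 : F) ((Fintype.card K - 1) * Fintype.card K ^ (n + 2)))
      (totalSumCount σ (0 : F) (-((Fintype.card K - 1) * Fintype.card K ^ (n + 2))))
      (totalSumCount σ w₀ 0)
      (totalSumCount σ w₀ ((Fintype.card K - 1) * Fintype.card K ^ (n + 2)))
      (totalSumCount σ w₀ (-((Fintype.card K - 1) * Fintype.card K ^ (n + 2))))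
      (totalSumCount σ w₀ ((Fintype.card K - 1) * Fintype.card K ^ (n + 3)))
      (totalSumCount σ w₀ (-((Fintype.card K - 1) * Fintype.card K ^ (n + 3))))) i := by
  classical
  have hF2 : (2 : F) ≠ 0 := by
    rw [← map_ofNat (algebraMap K F) 2]
    exact (_root_.map_ne_zero _).2 (Ring.two_ne_zero hK)
  have hF : (Fintype.card F : ℚ) = (Fintype.card K : ℚ) ^ (2 * n + 3) := by
    rw [← hn, Module.card_eq_pow_finrank (K := K) (V := F)]; push_cast; rfl
  have hq : (Fintype.card K : ℚ) ≠ 0 := by exact_mod_cast Fintype.card_ne_zero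
  have hinj := traceWord_fiveBases_injective hK hχ hfix hn hn0 hπ hσ h1 h2 hN hM hM0
  rw [weightCount_range_traceWord hπ hσ h1 h2 hN hM hM0 hF2 hinj, tableFrequency_eq]
  set q : ℚ := (Fintype.card K : ℚ) with hqdef
  set δ : ℚ → ℚ := fun x => if x = (i : ℚ) then 1 else 0 with hδ
  set g : ℤ → ℤ → ℚ := fun z z' =>
    δ ((2 * (q - 1) * Fintype.card F - z - z') / (2 * q)) with hg
  have s0 := sum_totalSum_zero hK hχ hfix hn hn0
  have s1 := fun {w : F} (hw : w ≠ 0) =>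
    sum_totalSum_of_ne_zero hK hχ hfix hn hneg hw hw₀
  -- Division by `(q-1)q` turns the total sums into `q^(2n+2)`, `0`, `±q^(n+1)`, `±q^(n+2)`, and the
  -- weight into `(q-1)(q^(2n+2) - (t + t')/2)`, as in the table.
  set E₀ : (ℚ → ℚ) → ℚ := fun f => ∑ a : F × F, f (totalSum σ a.1 a.2 0 / ((q - 1) * q)) with hE₀
  set E₁ : (ℚ → ℚ) → ℚ := fun f => ∑ a : F × F, f (totalSum σ a.1 a.2 w₀ / ((q - 1) * q)) with hE₁
  have hq1 : q - 1 ≠ 0 := by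
    have : (1 : ℚ) < q := by rw [hqdef]; exact_mod_cast Fintype.one_lt_card
    linarith
  have v1 : (((Fintype.card K : ℤ) - 1) * Fintype.card F : ℤ) / ((q - 1) * q) =
      q ^ (2 * n + 2) := by
    push_cast
    rw [hF, ← hqdef]
    field_simp
    ring
  have v2 : (((Fintype.card K : ℤ) - 1) * Fintype.card K ^ (n + 2) : ℤ) / ((q - 1) * q) =
      q ^ (n + 1) := by
    push_cast
    rw [← hqdef]
    field_simp
    ring
  have v3 : (((Fintype.card K : ℤ) - 1) * Fintype.card K ^ (n + 3) : ℤ) / ((q - 1) * q) =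
      q ^ (n + 2) := by
    push_cast
    rw [← hqdef]
    field_simp
    ring
  have key := double_sum_eq_weightTable δ (Fintype.card K) (2 * n + 3) (q ^ (2 * n + 2)) (q ^ (n + 1))
    (q ^ (n + 2)) (Fintype.card F - 1) _ _ _ _ _ _ _ _
    rfl
    (by rw [show (2 * n + 3 - 1) / 2 = n + 1 by omega])
    (by rw [show (2 * n + 3 + 1) / 2 = n + 2 by omega])
    (by rw [hF]) E₀ E₁
    (fun f => by
      rw [hE₀]
      dsimp only
      rw [s0 fun z => f (z / ((q - 1) * q)), v1, v2, Int.cast_neg, neg_div, v2, Int.cast_zero,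
        zero_div])
    (fun f => by
      rw [hE₁]
      dsimp only
      rw [s1 hw₀ fun z => f (z / ((q - 1) * q)), v2, v3, Int.cast_neg, neg_div, v2, Int.cast_neg,
        neg_div, v3, Int.cast_zero, zero_div])
  rw [← key, ← Finset.add_sum_erase _ _ (Finset.mem_univ (0 : F))]
  have harg : ∀ z z' : ℤ, (2 * (q - 1) * Fintype.card F - z - z') / (2 * q) =
      (q - 1) * (q ^ (2 * n + 2) - (z / ((q - 1) * q) + z' / ((q - 1) * q)) / 2) := by
    intro z z'
    rw [hF]
    field_simp
    ring
  congr 1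
  · simp only [zero_mul, harg, hE₀]
    rfl
  · have hc : ((Fintype.card F : ℚ) - 1) = ((Finset.univ.erase (0 : F)).card : ℚ) := by
      rw [Finset.card_erase_of_mem (Finset.mem_univ _), Finset.card_univ,
        Nat.cast_sub Fintype.card_pos, Nat.cast_one]
    rw [hc, ← nsmul_eq_mul, ← Finset.sum_const]
    refine Finset.sum_congr rfl fun w hw => ?_
    have hw0 : w ≠ 0 := Finset.ne_of_mem_erase hw
    have hw1 : w * (π : F) ^ e₂ ≠ 0 := mul_ne_zero hw0 (pow_ne_zero _ π.ne_zero)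
    -- Both `w` and `w π^e₂` are nonzero, so either sum may be replaced by the one at `w₀`; every `w
    -- ≠ 0` contributes the same amount.
    have hinner : ∀ (w : F), w ≠ 0 → ∀ f : ℤ → ℚ, ∑ a : F × F, f (totalSum σ a.1 a.2 w) =
        ∑ a : F × F, f (totalSum σ a.1 a.2 w₀) := fun w hw f => by
      rw [s1 hw, s1 hw₀]
    rw [hE₁]
    dsimp only
    rw [← hinner w hw0 fun z => ∑ a : F × F, δ ((q - 1) * (q ^ (2 * n + 2) -
      (z / ((q - 1) * q) + totalSum σ a.1 a.2 w₀ / ((q - 1) * q)) / 2))]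
    refine Finset.sum_congr rfl fun b _ => ?_
    rw [← hinner _ hw1 fun z' => δ ((q - 1) * (q ^ (2 * n + 2) -
      (totalSum σ b.1 b.2 w / ((q - 1) * q) + z' / ((q - 1) * q)) / 2))]
    refine Finset.sum_congr rfl fun b' _ => ?_
    rw [← harg]

omit [DecidableEq F] in
include hK hχ hfix hn hn0 hπ hσ h1 h2 hN hM hM0 in
-- The minimum weight occurs for `w = 0`, with one zero form and the other of total sum
-- `(|K|-1)|K|^(n+2)`, the largest value of a nonzero form with `w = 0`.
theorem hasParameters_range_traceWord (hneg : ∀ x, σ x = -x → x = 0) :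
    ∃ d : ℕ, (d : ℚ) = 1 / 2 * ((Fintype.card K : ℚ) - 1) *
      ((Fintype.card K : ℚ) ^ (2 * n + 2) - (Fintype.card K : ℚ) ^ (n + 1)) ∧
      HasParameters (LinearMap.range
        (traceWord K (fiveBases (π : F) ((π : F) ^ e₁) ((π : F) ^ e₂)) N))
        (5 * (2 * n + 3)) d := by
  classical
  have hF2 : (2 : F) ≠ 0 := by
    rw [← map_ofNat (algebraMap K F) 2]
    exact (_root_.map_ne_zero _).2 (Ring.two_ne_zero hK)
  have hF : (Fintype.card F : ℤ) = (Fintype.card K : ℤ) ^ (2 * n + 3) := by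
    rw [← hn, Module.card_eq_pow_finrank (K := K) (V := F)]; push_cast; rfl
  have hq : (1 : ℤ) < Fintype.card K := by exact_mod_cast Fintype.one_lt_card (α := K)
  have hinj := traceWord_fiveBases_injective hK hχ hfix hn hn0 hπ hσ h1 h2 hN hM hM0
  have hweight := two_mul_card_mul_hammingNorm hπ σ hσ h1 h2 hN hM hM0
  set L := traceWord K (fiveBases (π : F) ((π : F) ^ e₁) ((π : F) ^ e₂)) N with hL
  set e := formCoordinates hF2 π.ne_zero (pow_ne_zero e₁ π.ne_zero) with he
  have hex : ∃ b : F × F,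
      totalSum σ b.1 b.2 0 = ((Fintype.card K : ℤ) - 1) * Fintype.card K ^ (n + 2) := by
    have h := (totalSumCount_zero hK hχ hfix hneg hn _ rfl).2 1 (Or.inl rfl)
    have hpos : (0 : ℚ) < totalSumCount σ (0 : F)
        (1 * (((Fintype.card K : ℤ) - 1) * Fintype.card K ^ (n + 2))) := by
      rw [h]
      have hq' : (1 : ℚ) < Fintype.card K := by exact_mod_cast hq
      have : (1 : ℚ) < (Fintype.card K : ℚ) ^ (2 * n + 3) := one_lt_pow₀ hq' (by omega)
      push_cast
      have : (0 : ℚ) < (Fintype.card K : ℚ) ^ (2 * n + 3) - 1 := by linarith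
      positivity
    rw [one_mul] at hpos
    obtain ⟨b, hb⟩ := Finset.card_pos.1 (by exact_mod_cast hpos : 0 < (Finset.univ.filter
      fun a : F × F => totalSum σ a.1 a.2 0 =
        ((Fintype.card K : ℤ) - 1) * Fintype.card K ^ (n + 2)).card)
    exact ⟨b, (Finset.mem_filter.1 hb).2⟩
  obtain ⟨b, hb⟩ := hex
  obtain ⟨a, ha⟩ := e.surjective (0, (0, 0), b)
  have ha' : a 4 = 0 ∧ (a 0 + a 1 = 0 ∧ a 2 + a 3 = 0) ∧
      ((a 0 - a 1) * π, (a 2 - a 3) * (π : F) ^ e₁) = b := by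
    have h1 := congrArg Prod.fst ha
    have h2 := congrArg (fun r => r.2.1) ha
    have h3 := congrArg (fun r => r.2.2) ha
    exact ⟨h1, Prod.mk.injEq .. ▸ h2, h3⟩
  obtain ⟨a4, ⟨a01, a23⟩, ab⟩ := ha'
  have hwa := hweight a
  rw [a4, a01, a23, zero_mul, totalSum_zero] at hwa
  have hab : totalSum σ ((a 0 - a 1) * π) ((a 2 - a 3) * (π : F) ^ e₁) 0 =
      ((Fintype.card K : ℤ) - 1) * Fintype.card K ^ (n + 2) := by
    rw [← hb, ← ab]
  rw [hab] at hwa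
  have hlow : ∀ a' : Fin 5 → F, a' ≠ 0 → hammingNorm (L a) ≤ hammingNorm (L a') := by
    intro a' ha'
    have hw' := hweight a'
    have hqn : ((Fintype.card K : ℤ) - 1) * Fintype.card K ^ (n + 2) ≤
        ((Fintype.card K : ℤ) - 1) * Fintype.card F := by
      rw [hF]
      exact mul_le_mul_of_nonneg_left (pow_le_pow_right₀ hq.le (by omega)) (by linarith)
    have hbound : totalSum σ (a' 0 + a' 1) (a' 2 + a' 3) (a' 4) +
        totalSum σ ((a' 0 - a' 1) * π) ((a' 2 - a' 3) * (π : F) ^ e₁) (a' 4 * (π : F) ^ e₂) ≤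
        ((Fintype.card K : ℤ) - 1) * Fintype.card F +
          ((Fintype.card K : ℤ) - 1) * Fintype.card K ^ (n + 2) := by
      by_cases hw : a' 4 = 0
      · rw [hw, zero_mul]
        by_cases hu : a' 0 + a' 1 = 0 ∧ a' 2 + a' 3 = 0
        · rw [hu.1, hu.2, totalSum_zero]
          by_cases hv : (a' 0 - a' 1) * π = 0 ∧ (a' 2 - a' 3) * (π : F) ^ e₁ = 0
          · refine absurd (e.injective (a₂ := 0) ?_) ha'
            change (a' 4, (a' 0 + a' 1, a' 2 + a' 3), ((a' 0 - a' 1) * (π : F),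
              (a' 2 - a' 3) * (π : F) ^ e₁)) =
              ((0 : F), ((0 : F) + 0, (0 : F) + 0), ((0 - 0) * (π : F), (0 - 0) * (π : F) ^ e₁))
            rw [hw, hu.1, hu.2, hv.1, hv.2]
            simp
          · linarith [totalSum_le_of_eq_zero hK hχ hfix hn hv]
        · have k1 := totalSum_le_of_eq_zero hK hχ hfix hn hu
          by_cases hv : (a' 0 - a' 1) * π = 0 ∧ (a' 2 - a' 3) * (π : F) ^ e₁ = 0
          · rw [hv.1, hv.2, totalSum_zero]
            linarith
          · linarith [totalSum_le_of_eq_zero hK hχ hfix hn hv]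
      · have k1 := totalSum_le_of_ne_zero hK hχ hfix hn
          (u := a' 0 + a' 1) (v := a' 2 + a' 3) (w := a' 4) (fun h => hw h.2.2)
        have k2 := totalSum_le_of_ne_zero hK hχ hfix hn
          (u := (a' 0 - a' 1) * π) (v := (a' 2 - a' 3) * (π : F) ^ e₁) (w := a' 4 * (π : F) ^ e₂)
          (fun h => mul_ne_zero hw (pow_ne_zero _ π.ne_zero) h.2.2)
        -- For `w ≠ 0` both forms are nonzero; even two values `|K|^(n+3)` do not exceed the
        -- contribution of one zero form, because `|K| ≥ 2` and `n ≥ 1`.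
        have k3 : 2 * (Fintype.card K : ℤ) ^ (n + 3) ≤ Fintype.card F := by
          rw [hF]
          calc 2 * (Fintype.card K : ℤ) ^ (n + 3) ≤ Fintype.card K * Fintype.card K ^ (n + 3) :=
                mul_le_mul_of_nonneg_right hq (by positivity)
            _ = (Fintype.card K : ℤ) ^ (n + 4) := by ring
            _ ≤ _ := pow_le_pow_right₀ hq.le (by omega)
        have k4 := mul_le_mul_of_nonneg_left k3 (by linarith : 0 ≤ (Fintype.card K : ℤ) - 1)
        have k5 : 0 ≤ ((Fintype.card K : ℤ) - 1) * Fintype.card K ^ (n + 2) :=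
          mul_nonneg (by linarith) (by positivity)
        linarith
    have : (2 * (Fintype.card K : ℤ)) * hammingNorm (L a) ≤
        (2 * (Fintype.card K : ℤ)) * hammingNorm (L a') := by
      rw [hwa, hw']
      linarith
    exact_mod_cast le_of_mul_le_mul_left this (by positivity)
  refine ⟨hammingNorm (L a), ?_, ?_, ?_, ?_⟩
  · have h := congrArg (Int.cast : ℤ → ℚ) hwa
    rw [hF] at h
    push_cast at h
    have hq0 : (2 * (Fintype.card K : ℚ)) ≠ 0 := by
      have : (Fintype.card K : ℚ) ≠ 0 := by exact_mod_cast Fintype.card_ne_zero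
      exact mul_ne_zero two_ne_zero this
    apply mul_left_cancel₀ hq0
    rw [h]
    ring
  · rw [LinearMap.finrank_range_of_inj hinj, Module.finrank_pi_fintype]
    simp [hn]
  · refine ⟨0, ⟨0, map_zero _⟩, L a, ⟨a, rfl⟩, ?_, ?_⟩
    · intro h
      rw [← h, hammingNorm_zero, hF] at hwa
      have k : ((Fintype.card K : ℤ) - 1) * Fintype.card K ^ (n + 2) <
          ((Fintype.card K : ℤ) - 1) * Fintype.card K ^ (2 * n + 3) :=
        mul_lt_mul_of_pos_left (pow_lt_pow_right₀ hq (by omega)) (by linarith)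
      rw [Nat.cast_zero, mul_zero] at hwa
      linarith
    · rw [hammingDist_eq_hammingNorm, neg_zero, zero_add]
  · rintro _ ⟨_, ⟨x, rfl⟩, _, ⟨y, rfl⟩, hxy, rfl⟩
    rw [hammingDist_eq_hammingNorm, neg_add_eq_sub, ← map_sub]
    exact hlow _ fun h => hxy (by rw [sub_eq_zero.1 h])

end TraceCode

/-! ### Translation to the exponential sums and the five-zero polynomial -/

section ExponentialSums

variable {p : ℕ} [Fact p.Prime] {F : Type*} [Field F] [Fintype F] [Algebra (ZMod p) F]

theorem expSumD_eq_totalSum {k : ℕ} {ζ : ℂ} (hζ : IsPrimitiveRoot ζ p) (u v w : F) :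
    expSumD p k ζ u v w = totalSum (frobPow p F k) u v w := by
  rw [← sum_formSum (AddChar.zmodChar_primitive_of_primitive_root p hζ)]
  refine Finset.sum_congr rfl fun y _ => Finset.sum_congr rfl fun x _ => ?_
  rw [AddChar.zmodChar_apply, twistedForm_apply, frobPow_apply, frobPow_apply, ← pow_mul, ← pow_add,
    ← two_mul, sq, pow_succ', pow_succ']

theorem countD_eq_totalSumCount {k : ℕ} {ζ : ℂ} (hζ : IsPrimitiveRoot ζ p) (w : F) {z : ℂ} {z' : ℤ}
    (hz : z = z') : countD p k ζ w z = totalSumCount (frobPow p F k) w z' := by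
  rw [countD, totalSumCount, ← Set.ncard_coe_finset]
  congr 1
  ext a
  simp [expSumD_eq_totalSum hζ, hz]

omit [Fintype F] in
theorem fiveZeroPoly_eq_prod (k : ℕ) (π : F) : fiveZeroPoly p k π =
    ∏ i, minpoly (ZMod p)
      (fiveBases π (π ^ ((p ^ k + 1) / 2)) (π ^ ((p ^ (2 * k) + 1) / 2)) i)⁻¹ := by
  simp only [Fin.prod_univ_five, fiveBases, fiveZeroPoly, Matrix.cons_val, inv_neg]

end ExponentialSums

theorem theorem4p4 (p m k : ℕ) [Fact p.Prime] (hp : p ≠ 2) (hm : 5 ≤ m) (hm_odd : Odd m)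
    (hk : 0 < k) (hmk : Nat.gcd m k = 1)
    (F : Type*) [Field F] [Fintype F] [Algebra (ZMod p) F] (hF : Fintype.card F = p ^ m)
    (π : Fˣ) (hπ : Subgroup.zpowers π = ⊤)
    (ζ : ℂ) (hζ : IsPrimitiveRoot ζ p) :
    -- the code is cyclic, with the given parity-check polynomial
    IsCyclicCode (fiveZeroCode p m k (π : F)) ∧
    IsParityCheckPolynomial (fiveZeroCode p m k (π : F)) (fiveZeroPoly p k (π : F)) ∧
    -- its dimension and minimum distance
    (∃ d : ℕ, (d : ℚ) = 1 / 2 * ((p : ℚ) - 1) * ((p : ℚ) ^ (m - 1) - (p : ℚ) ^ ((m - 1) / 2)) ∧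
      HasParameters (fiveZeroCode p m k (π : F)) (5 * m) d) ∧
    -- its weight distribution, in terms of the counts
    (∀ w : F, w ≠ 0 → ∀ i : ℕ,
      (weightCount (fiveZeroCode p m k (π : F)) i : ℚ) =
        tableFrequency
          (weightTable p m
            (countD p k ζ (0 : F) 0)
            (countD p k ζ (0 : F) (((p : ℂ) - 1) * (p : ℂ) ^ ((m + 1) / 2)))
            (countD p k ζ (0 : F) (-(((p : ℂ) - 1) * (p : ℂ) ^ ((m + 1) / 2))))
            (countD p k ζ w 0)
            (countD p k ζ w (((p : ℂ) - 1) * (p : ℂ) ^ ((m + 1) / 2)))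
            (countD p k ζ w (-(((p : ℂ) - 1) * (p : ℂ) ^ ((m + 1) / 2))))
            (countD p k ζ w (((p : ℂ) - 1) * (p : ℂ) ^ ((m + 3) / 2)))
            (countD p k ζ w (-(((p : ℂ) - 1) * (p : ℂ) ^ ((m + 3) / 2))))) i) ∧
    -- the values of the counts for `w = 0`
    ((countD p k ζ (0 : F) 0 : ℚ) =
        ((p : ℚ) ^ m - 1) * ((p : ℚ) ^ m - (p : ℚ) ^ (m - 1) + 1) ∧
      (countD p k ζ (0 : F) (((p : ℂ) - 1) * (p : ℂ) ^ ((m + 1) / 2)) : ℚ) =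
        1 / 2 * ((p : ℚ) ^ m - 1) * ((p : ℚ) ^ (m - 1) + (p : ℚ) ^ ((m - 1) / 2)) ∧
      (countD p k ζ (0 : F) (-(((p : ℂ) - 1) * (p : ℂ) ^ ((m + 1) / 2))) : ℚ) =
        1 / 2 * ((p : ℚ) ^ m - 1) * ((p : ℚ) ^ (m - 1) - (p : ℚ) ^ ((m - 1) / 2))) ∧
    -- the values of the counts for `w ≠ 0`
    (∀ w : F, w ≠ 0 →
      (countD p k ζ w 0 : ℚ) =
        (p : ℚ) ^ (2 * m) - (p : ℚ) ^ (2 * m - 1) + (p : ℚ) ^ (2 * m - 4) - (p : ℚ) ^ (m - 3) ∧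
      (countD p k ζ w (((p : ℂ) - 1) * (p : ℂ) ^ ((m + 1) / 2)) : ℚ) =
        ((p : ℚ) ^ (m + 2) - (p : ℚ) ^ m - (p : ℚ) ^ (m - 1) + 1) *
          ((p : ℚ) ^ (m - 1) + (p : ℚ) ^ ((m - 1) / 2)) / (2 * ((p : ℚ) ^ 2 - 1)) ∧
      (countD p k ζ w (-(((p : ℂ) - 1) * (p : ℂ) ^ ((m + 1) / 2))) : ℚ) =
        ((p : ℚ) ^ (m + 2) - (p : ℚ) ^ m - (p : ℚ) ^ (m - 1) + 1) *
          ((p : ℚ) ^ (m - 1) - (p : ℚ) ^ ((m - 1) / 2)) / (2 * ((p : ℚ) ^ 2 - 1)) ∧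
      (countD p k ζ w (((p : ℂ) - 1) * (p : ℂ) ^ ((m + 3) / 2)) : ℚ) =
        ((p : ℚ) ^ (m - 1) - 1) *
          ((p : ℚ) ^ (m - 3) + (p : ℚ) ^ ((m - 3) / 2)) / (2 * ((p : ℚ) ^ 2 - 1)) ∧
      (countD p k ζ w (-(((p : ℂ) - 1) * (p : ℂ) ^ ((m + 3) / 2))) : ℚ) =
        ((p : ℚ) ^ (m - 1) - 1) *
          ((p : ℚ) ^ (m - 3) - (p : ℚ) ^ ((m - 3) / 2)) / (2 * ((p : ℚ) ^ 2 - 1))) := by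
  classical
  -- In terms of `n` the exponents `(m ± 1)/2`, `(m + 3)/2` and `(m - 3)/2` are exact, and `m ≥ 5`
  -- becomes `n > 0`.
  obtain ⟨n, rfl⟩ : ∃ n, m = 2 * n + 3 := by
    obtain ⟨r, rfl⟩ := hm_odd
    exact ⟨r - 1, by omega⟩
  have hn0 : 0 < n := by omega
  have hp1 : 1 < p := (Fact.out : p.Prime).one_lt
  have hpodd : Odd p := (Fact.out : p.Prime).odd_of_ne_two hp
  have hfin : Module.finrank (ZMod p) F = 2 * n + 3 := by
    have h := Module.card_eq_pow_finrank (K := ZMod p) (V := F)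
    rw [hF, ZMod.card] at h
    exact (Nat.pow_right_injective hp1 h).symm
  have hK : ringChar (ZMod p) ≠ 2 := by rwa [ZMod.ringChar_zmod_n]
  have hχ := AddChar.zmodChar_primitive_of_primitive_root p hζ
  have hfix := exists_algebraMap_eq_of_frobPow_eq (p := p) (F := F) (k := k) (by rwa [hfin])
  have hneg := eq_zero_of_frobPow_eq_neg (p := p) (F := F) (k := k) hp (by rwa [hfin])
  have hσ := frobPow_apply (p := p) (F := F) k
  -- Since `p` is odd, both halves are exact, as required of `e₁` and `e₂`.
  have he1 : p ^ k + 1 = 2 * ((p ^ k + 1) / 2) :=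
    (Nat.mul_div_cancel' (hpodd.pow.add_odd odd_one).two_dvd).symm
  have he2 : (p ^ k) ^ 2 + 1 = 2 * ((p ^ (2 * k) + 1) / 2) := by
    rw [← pow_mul, mul_comm k]
    exact (Nat.mul_div_cancel' (hpodd.pow.add_odd odd_one).two_dvd).symm
  have hN : p ^ (2 * n + 3) - 1 = Fintype.card F - 1 := by rw [hF]
  have hlt : 1 < p ^ (2 * n + 3) := Nat.one_lt_pow (by omega) hp1
  obtain ⟨M, hM'⟩ : Odd (p ^ (2 * n + 3)) := hpodd.pow
  have hM : Fintype.card F - 1 = 2 * M := by rw [hF, hM']; omega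
  have hM0 : 0 < M := by omega
  have hNpos : 0 < p ^ (2 * n + 3) - 1 := by omega
  have hinj := traceWord_fiveBases_injective hK hχ hfix hfin hn0 hπ hσ he1 he2 hN hM hM0
  have hγ0 : ∀ i, fiveBases (π : F) ((π : F) ^ ((p ^ k + 1) / 2))
      ((π : F) ^ ((p ^ (2 * k) + 1) / 2)) i ≠ 0 := by
    intro i
    fin_cases i <;> simp [fiveBases]
  have hγ : ∀ i, fiveBases (π : F) ((π : F) ^ ((p ^ k + 1) / 2))
      ((π : F) ^ ((p ^ (2 * k) + 1) / 2)) i ^ (p ^ (2 * n + 3) - 1) = 1 := by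
    intro i
    rw [hN]
    exact FiniteField.pow_card_sub_one_eq_one _ (hγ0 i)
  obtain ⟨hpar, hcode⟩ := codeOfParityCheck_prod_minpoly hNpos hγ hγ0 hinj
  rw [← fiveZeroPoly_eq_prod] at hpar hcode
  have hC : fiveZeroCode p (2 * n + 3) k (π : F) = _ := hcode
  have hcard : Fintype.card (ZMod p) = p := ZMod.card p
  have hdist := fun (w₀ : F) (hw₀ : w₀ ≠ 0) =>
    weightCount_eq_tableFrequency hK hχ hfix hfin hn0 hπ hσ he1 he2 hN hM hM0 hneg hw₀
  obtain ⟨d, hd, hparam⟩ :=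
    hasParameters_range_traceWord hK hχ hfix hfin hn0 hπ hσ he1 he2 hN hM hM0 hneg
  obtain ⟨z0, z⟩ := totalSumCount_zero hK hχ hfix hneg hfin p (by rw [hcard])
  have nz := fun (w : F) (hw : w ≠ 0) =>
    totalSumCount_ne_zero hK hχ hfix hneg hfin p (by rw [hcard]) hw
  have x1 : (2 * n + 3 - 1) = 2 * n + 2 := by omega
  have x2 : (2 * n + 2) / 2 = n + 1 := by omega
  have x3 : (2 * n + 3 + 1) / 2 = n + 2 := by omega
  have x4 : (2 * n + 3 + 3) / 2 = n + 3 := by omega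
  have x5 : 2 * n + 3 - 3 = 2 * n := by omega
  have x6 : 2 * n / 2 = n := by omega
  have x7 : 2 * (2 * n + 3) = 4 * n + 6 := by ring
  have x8 : 4 * n + 6 - 1 = 4 * n + 5 := by omega
  have x9 : 4 * n + 6 - 4 = 4 * n + 2 := by omega
  have c0 : ∀ w : F, countD p k ζ w 0 = totalSumCount (frobPow p F k) w 0 :=
    fun w => countD_eq_totalSumCount hζ w (by simp)
  have c1 : ∀ (w : F) (j : ℕ), countD p k ζ w (((p : ℂ) - 1) * (p : ℂ) ^ j) =
      totalSumCount (frobPow p F k) w (((p : ℤ) - 1) * (p : ℤ) ^ j) :=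
    fun w j => countD_eq_totalSumCount hζ w (by push_cast; rfl)
  have c2 : ∀ (w : F) (j : ℕ), countD p k ζ w (-(((p : ℂ) - 1) * (p : ℂ) ^ j)) =
      totalSumCount (frobPow p F k) w (-(((p : ℤ) - 1) * (p : ℤ) ^ j)) :=
    fun w j => countD_eq_totalSumCount hζ w (by push_cast; rfl)
  have z1 := z 1 (Or.inl rfl)
  have z2 := z (-1) (Or.inr rfl)
  rw [hcard] at z1 z2 hd
  simp only [hcard] at hdist nz
  simp only [one_mul, neg_one_mul, Int.cast_one, Int.cast_neg, ← sub_eq_add_neg] at z1 z2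
  simp only [x1, x2, x3, x4, x5, x6, x7, x8, x9, c0, c1, c2, hC]
  refine ⟨isCyclicCode_range_traceWord _ hγ hγ0, hC ▸ hpar, ⟨d, hd, hparam⟩, hdist,
    ⟨z0, z1, z2⟩, fun w hw => ?_⟩
  obtain ⟨n0, n1⟩ := nz w hw
  have p1 := n1 1 (Or.inl rfl)
  have p2 := n1 (-1) (Or.inr rfl)
  simp only [one_mul, neg_one_mul, Int.cast_one, Int.cast_neg, ← sub_eq_add_neg] at p1 p2
  exact ⟨n0, p1.1, p2.1, p1.2, p2.2⟩
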